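/- Let $E$ and $A\neq\emptyset$ be Borel (Lusin) spaces, i.e. topological spaces homeomorphic to Borel subsets of compact metric spaces, with their Borel $\sigma$-algebras, and let $T\in(0,\infty)$. Let $\lambda$ be a measure transition kernel from $E\times A$ to $E$ with $\sup_{x\in E,a\in A}\lambda(x,a,E)<\infty$ which is Feller: for every bounded continuous $\phi:E\to\mathbb R$ the function $(x,a)\mapsto\int_E\phi(y)\,\lambda(x,a,dy)$ is continuous. Let $f:[0,T]\times E\times A\to\mathbb R$ and $g:E\to\mathbb R$ be bounded and lower semicontinuous. *Control problem.* An admissible control is a Borel map $\alpha:[0,T]\times E\to A$, and $\nu^\alpha(t,x,dy)=\lambda(x,\alpha(t,x),dy)$ is the corresponding rate transition measure (for times after $T$ any Borel extension of $\alpha$ is used; this does not affect what follows). For $t\in[0,T]$ and $x\in E$, let $\mathbb P^{t,x}_\alpha$ be the law of the marked point process $(T_n,E_n)_{n\ge 0}$ with $(T_0,E_0)=(t,x)$ and rate transition measure $\nu^\alpha$: given the past up to the $n$-th jump and $(T_n,E_n)=(s,e)$, the pair $(T_{n+1},E_{n+1})$ has on $(s,\infty)\times E$ the law $$\exp\Big(-\int_s^r\nu^\alpha(u,e,E)\,du\Big)\,\nu^\alpha(r,e,dy)\,dr,$$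 and with the remaining probability there are no further jumps. Let $X$ be the associated pure jump process, $X_s=E_0$ for $s\le T_1$ and $X_s=E_n$ for $T_n<s\le T_{n+1}$. Define $$J(t,x,\alpha)=\mathbb E^{t,x}_\alpha\Big[\int_t^T f(s,X_s,\alpha(s,X_s))\,ds+g(X_T)\Big],\qquad V(t,x)=\sup_\alpha J(t,x,\alpha),$$ the supremum being taken over all admissible controls. *HJB equation.* A bounded Borel function $v:[0,T]\times E\to\mathbb R$ is a solution of the HJB equation if the function $$H_v(t,x)=\sup_{a\in A}\Big(\int_E(v(t,y)-v(t,x))\,\lambda(x,a,dy)+f(t,x,a)\Big)$$ is Borel on $[0,T]\times E$ and, for every $x\in E$, $v(T,x)=g(x)$, the map $t\mapsto v(t,x)$ is absolutely continuous on $[0,T]$, and $-\frac{\partial v}{\partial t}(t,x)=H_v(t,x)$ for almost every $t\in[0,T]$ (the null set may depend on $x$). **Theorem.** The random variables in the definition of $J$ are integrable, and for each $(t,x)\in[0,T]\times E$ the set $\{J(t,x,\alpha)\}_\alpha$ is bounded above, so that $J$ and $V$ are well defined. There is exactly one bounded lower semicontinuous function $v:[0,T]\times E\to\mathbb R$ that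 solves the HJB equation, and $v(t,x)=V(t,x)$ for all $(t,x)\in[0,T]\times E$. -/

import Mathlib

open MeasureTheory ProbabilityTheory Set Filter Topology
open scoped ENNReal NNReal

noncomputable section

namespace PureJump

/-! ### State spaces -/

/-- A topological space homeomorphic to a Borel subset of a compact metric space. -/
def IsLusinSpace (S : Type*) [TopologicalSpace S] : Prop :=
  ∃ (K : Type) (_ : MetricSpace K) (_ : CompactSpace K) (i : S → K),
    IsEmbedding i ∧ MeasurableSet[borel K] (range i)

/-! ### The law of the marked point process with a given rate transition measure -/

section Law

variable {E : Type*} [MeasurableSpace E]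

/-- The possible values of `(T_n, E_n)`: either a finite jump time together with a mark in `E`, or
the cemetery `Sum.inr () = (∞, Δ)`. -/
abbrev Mark (E : Type*) := (ℝ × E) ⊕ Unit

/-- The probability of not having jumped yet at time `r` when the process sits in `p.2` since time
`p.1`: it is `exp (- ∫_{p.1}^r ν(u, p.2, E) du)` for `r > p.1`, and `0` otherwise. -/
def survival (ν : Kernel (ℝ × E) E) (p : ℝ × E) (r : ℝ) : ℝ≥0 :=
  (Ioi p.1).indicator
    (fun r => (Real.exp (-∫ u in p.1..r, (ν (u, p.2)).real univ)).toNNReal) r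

/-- Law of the next jump time and of the next mark on `{next jump time < ∞}`, given that the last
jump `p = (s, e)` occurred at time `s` and had mark `e`; it is the measure
`1_{r > s} exp (- ∫_s^r ν(u, e, E) du) ν(r, e, dy) dr` on `ℝ × E`, whose mass may be less than one. -/
def finiteJump (ν : Kernel (ℝ × E) E) : Kernel (ℝ × E) (ℝ × E) :=
  (Kernel.withDensity (Kernel.const (ℝ × E) (volume : Measure ℝ))
      (fun p r => (survival ν p r : ℝ≥0∞))) ⊗ₖ
    (ν.comap (fun q : (ℝ × E) × ℝ => (q.2, q.1.2)) (by fun_prop))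

lemma measurable_survival (ν : Kernel (ℝ × E) E) [IsFiniteKernel ν] :
    Measurable (Function.uncurry (survival ν)) := by
  have hν : Measurable fun z : ((ℝ × E) × ℝ) × ℝ => (ν (z.2, z.1.1.2)).real univ :=
    (((Kernel.measurable_coe ν MeasurableSet.univ).comp
      (by fun_prop : Measurable fun z : ((ℝ × E) × ℝ) × ℝ => (z.2, z.1.1.2)))).ennreal_toReal
  have h1 : Measurable fun w : (ℝ × E) × ℝ =>
      ∫ u in Ioc w.1.1 w.2, (ν (u, w.1.2)).real univ := by
    simp_rw [← integral_indicator measurableSet_Ioc]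
    have : Measurable fun z : ((ℝ × E) × ℝ) × ℝ =>
        (Ioc z.1.1.1 z.1.2).indicator (fun u => (ν (u, z.1.1.2)).real univ) z.2 := by
      simp only [indicator, mem_Ioc]
      have hS : MeasurableSet {z : ((ℝ × E) × ℝ) × ℝ | z.1.1.1 < z.2 ∧ z.2 ≤ z.1.2} := by
        have h1 : MeasurableSet {z : ((ℝ × E) × ℝ) × ℝ | z.1.1.1 < z.2} :=
          measurableSet_lt (by fun_prop) (by fun_prop)
        have h2 : MeasurableSet {z : ((ℝ × E) × ℝ) × ℝ | z.2 ≤ z.1.2} :=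
          measurableSet_le (by fun_prop) (by fun_prop)
        simpa only [ofPred_and] using h1.inter h2
      exact Measurable.ite hS hν measurable_const
    exact (this.stronglyMeasurable.integral_prod_right' (ν := volume)).measurable
  have h2 : Measurable fun w : (ℝ × E) × ℝ =>
      ∫ u in Ioc w.2 w.1.1, (ν (u, w.1.2)).real univ := by
    simp_rw [← integral_indicator measurableSet_Ioc]
    have : Measurable fun z : ((ℝ × E) × ℝ) × ℝ =>
        (Ioc z.1.2 z.1.1.1).indicator (fun u => (ν (u, z.1.1.2)).real univ) z.2 := by
      simp only [indicator, mem_Ioc]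
      have hS : MeasurableSet {z : ((ℝ × E) × ℝ) × ℝ | z.1.2 < z.2 ∧ z.2 ≤ z.1.1.1} := by
        have h1 : MeasurableSet {z : ((ℝ × E) × ℝ) × ℝ | z.1.2 < z.2} :=
          measurableSet_lt (by fun_prop) (by fun_prop)
        have h2 : MeasurableSet {z : ((ℝ × E) × ℝ) × ℝ | z.2 ≤ z.1.1.1} :=
          measurableSet_le (by fun_prop) (by fun_prop)
        simpa only [ofPred_and] using h1.inter h2
      exact Measurable.ite hS hν measurable_const
    exact (this.stronglyMeasurable.integral_prod_right' (ν := volume)).measurable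
  have h3 : Measurable fun w : (ℝ × E) × ℝ =>
      (Real.exp (-∫ u in w.1.1..w.2, (ν (u, w.1.2)).real univ)).toNNReal := by
    simp only [intervalIntegral]
    exact (Real.measurable_exp.comp (h1.sub h2).neg).real_toNNReal
  simp only [Function.uncurry_def, survival, indicator, mem_Ioi]
  exact Measurable.ite (measurableSet_lt (by fun_prop) (by fun_prop)) h3 measurable_const

/-- The explicit formula for `finiteJump`. -/
lemma lintegral_finiteJump (ν : Kernel (ℝ × E) E) [IsFiniteKernel ν] (p : ℝ × E)
    {φ : ℝ × E → ℝ≥0∞} (hφ : Measurable φ) :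
    ∫⁻ z, φ z ∂(finiteJump ν p)
      = ∫⁻ r in Ioi p.1, ENNReal.ofReal (Real.exp (-∫ u in p.1..r, (ν (u, p.2)).real univ)) *
          ∫⁻ y, φ (r, y) ∂(ν (r, p.2)) := by
  have hs : Measurable (Function.uncurry fun p r => (survival ν p r : ℝ≥0∞)) :=
    (measurable_survival ν).coe_nnreal_ennreal
  have hk : Measurable fun r : ℝ => ∫⁻ y, φ (r, y) ∂(ν (r, p.2)) :=
    Measurable.lintegral_kernel_prod_right (κ := ν.comap (fun r : ℝ => (r, p.2)) (by fun_prop)) hφ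
  rw [finiteJump, Kernel.lintegral_compProd _ _ _ hφ]
  simp only [Kernel.comap_apply]
  rw [Kernel.lintegral_withDensity _ hs _ hk, Kernel.const_apply,
    ← lintegral_indicator measurableSet_Ioi]
  refine lintegral_congr fun r => ?_
  by_cases hr : r ∈ Ioi p.1
  · simp [survival, indicator_of_mem hr, ENNReal.ofReal]
  · simp [survival, indicator_of_notMem hr]

lemma finiteJump_univ_le_one (ν : Kernel (ℝ × E) E) [IsFiniteKernel ν] (p : ℝ × E) :
    finiteJump ν p univ ≤ 1 := by
  obtain ⟨s, e⟩ := p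
  set q : ℝ → ℝ := fun u => (ν (u, e)).real univ with hq
  have hqm : Measurable q :=
    ((Kernel.measurable_coe ν MeasurableSet.univ).comp
      (by fun_prop : Measurable fun u : ℝ => (u, e))).ennreal_toReal
  have hq0 : ∀ u, 0 ≤ q u := fun u => measureReal_nonneg
  set B : ℝ := (ν.bound).toReal with hB
  have hqB : ∀ u, q u ≤ B := fun u =>
    ENNReal.toReal_mono ν.bound_ne_top (ν.measure_le_bound _ _)
  have hqi : ∀ a b, IntervalIntegrable q volume a b := fun a b =>
    (intervalIntegrable_const (c := B)).mono_fun hqm.aestronglyMeasurable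
      (ae_of_all _ fun u => by
        beta_reduce
        rw [Real.norm_of_nonneg (hq0 u), Real.norm_of_nonneg ((hq0 u).trans (hqB u))]
        exact hqB u)
  set F : ℝ → ℝ := fun r => Real.exp (-∫ u in s..r, q u) with hF
  have hQc : Continuous fun r => ∫ u in s..r, q u :=
    intervalIntegral.continuous_primitive hqi s
  have hFc : Continuous F := Real.continuous_exp.comp hQc.neg
  have key : ∀ b, s ≤ b → ∫ r in s..b, F r * q r ≤ 1 := by
    intro b hb
    have hlq : LocallyIntegrable q volume := by
      rw [locallyIntegrable_iff]
      intro K hK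
      obtain ⟨a, ha⟩ := hK.isBounded.subset_closedBall 0
      rw [Real.closedBall_eq_Icc] at ha
      exact ((integrableOn_Icc_iff_integrableOn_Ioc).2
        (hqi (0 - a) (0 + a)).1).mono_set ha
    have hder : ∀ᵐ r, HasDerivAt (fun r => -F r) (F r * q r) r := by
      filter_upwards [LocallyIntegrable.ae_hasDerivAt_integral hlq] with r hr
      have h := HasDerivAt.fun_neg (HasDerivAt.fun_neg (hr s)).exp
      exact h.congr_deriv (by simp [hF])
    have hmono : MonotoneOn (fun r => -F r) (uIcc s b) := by
      intro x _ y _ hxy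
      simp only [hF, neg_le_neg_iff]
      refine Real.exp_le_exp.2 (neg_le_neg ?_)
      rw [← intervalIntegral.integral_add_adjacent_intervals (hqi s x) (hqi x y)]
      have := intervalIntegral.integral_nonneg (μ := volume) hxy fun u _ => hq0 u
      linarith
    have hmem := hmono.intervalIntegral_deriv_mem_uIcc
    have heq : ∫ r in s..b, deriv (fun r => -F r) r = ∫ r in s..b, F r * q r :=
      intervalIntegral.integral_congr_ae (by
        filter_upwards [hder] with r hr _ using hr.deriv)
    have hle : (0 : ℝ) ≤ -F b - -F s :=
      sub_nonneg.2 (hmono left_mem_uIcc right_mem_uIcc hb)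
    rw [heq, uIcc_of_le hle] at hmem
    have h1 : F s = 1 := by simp [hF]
    have h2 : 0 ≤ F b := (Real.exp_pos _).le
    linarith [hmem.2]
  have h0 := lintegral_finiteJump ν (s, e) (φ := fun _ => 1) measurable_const
  simp only [lintegral_const, one_mul] at h0
  rw [h0]
  have hU : Ioi s = ⋃ n : ℕ, Ioc s (s + n) := by
    ext r
    simp only [mem_Ioi, mem_iUnion, mem_Ioc]
    constructor
    · intro hr
      obtain ⟨n, hn⟩ := exists_nat_ge (r - s)
      exact ⟨n, hr, by linarith⟩
    · rintro ⟨n, hr, _⟩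
      exact hr
  have hdir : Directed (· ⊆ ·) fun n : ℕ => Ioc s (s + n) :=
    Monotone.directed_le fun m n hmn => Ioc_subset_Ioc_right (by
      have : (m : ℝ) ≤ n := by exact_mod_cast hmn
      linarith)
  rw [hU, setLIntegral_iUnion_of_directed _ hdir]
  refine iSup_le fun n => ?_
  have hpt : ∀ r, ENNReal.ofReal (Real.exp (-∫ u in s..r, (ν (u, e)).real univ)) *
      ν (r, e) univ = ENNReal.ofReal (F r * q r) := by
    intro r
    rw [ENNReal.ofReal_mul (Real.exp_pos _).le]
    simp [hq, measureReal_def]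
  simp_rw [hpt]
  have hn : s ≤ s + n := by simp
  have hint : IntervalIntegrable (fun r => F r * q r) volume s (s + n) :=
    (hqi s (s + n)).continuousOn_mul hFc.continuousOn
  rw [← ofReal_integral_eq_lintegral_ofReal hint.1
    (ae_of_all _ fun r => mul_nonneg (Real.exp_pos _).le (hq0 r)),
    ← intervalIntegral.integral_of_le hn]
  exact ENNReal.ofReal_le_one.2 (key _ hn)

/-- Transition kernel of the Markov chain `(T_n, E_n)`: from `(s, e)` the next pair has law
`finiteJump ν (s, e)` on finite times, and equals `(∞, Δ)` with the remaining probability; `(∞, Δ)`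
is absorbing. -/
def jumpKernel (ν : Kernel (ℝ × E) E) [IsFiniteKernel ν] : Kernel (Mark E) (Mark E) where
  toFun := Sum.elim
    (fun p => (finiteJump ν p).map Sum.inl + (1 - finiteJump ν p univ) • Measure.dirac (Sum.inr ()))
    (fun _ => Measure.dirac (Sum.inr ()))
  measurable' := by
    refine Measurable.sumElim ?_ measurable_const
    refine Measure.measurable_of_measurable_coe _ fun s hs => ?_
    simp only [Measure.coe_add, Measure.coe_smul, Pi.add_apply, Pi.smul_apply, smul_eq_mul]
    simp_rw [Measure.map_apply measurable_inl hs]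
    exact (Kernel.measurable_coe _ (measurable_inl hs)).add
      ((measurable_const.sub (Kernel.measurable_coe _ MeasurableSet.univ)).mul_const _)

instance (ν : Kernel (ℝ × E) E) [IsFiniteKernel ν] : IsMarkovKernel (jumpKernel ν) := by
  refine ⟨fun m => ⟨?_⟩⟩
  rcases m with p | u
  · change ((finiteJump ν p).map Sum.inl +
      (1 - finiteJump ν p univ) • Measure.dirac (Sum.inr ()) : Measure (Mark E)) univ = 1
    simp [Measure.map_apply measurable_inl MeasurableSet.univ,
      add_tsub_cancel_of_le (finiteJump_univ_le_one ν p)]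
  · change (Measure.dirac (Sum.inr ()) : Measure (Mark E)) univ = 1
    simp

/-- The law `P^{t,μ}` of the sequence `(T_n, E_n)_{n ≥ 0}` on the canonical space, when the rate
transition measure is `ν`, the starting time is `t` (so `T_0 = t`) and the initial distribution
(the law of `E_0`) is `μ`. -/
def jumpLaw (ν : Kernel (ℝ × E) E) [IsFiniteKernel ν] (t : ℝ) (μ : Measure E)
    [IsProbabilityMeasure μ] : Measure (ℕ → Mark E) :=
  Kernel.trajMeasure (X := fun _ => Mark E) (μ.map fun e => Sum.inl (t, e))
    (fun n => (jumpKernel ν).comap (fun h => h ⟨n, Finset.mem_Iic.2 le_rfl⟩) (by fun_prop))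

/-- The jump time `T_n ∈ (-∞, ∞]` carried by a mark. -/
def Mark.time : Mark E → EReal := Sum.elim (fun p => (p.1 : EReal)) (fun _ => ⊤)

/-- The position `E_n ∈ E ∪ {Δ}` carried by a mark, with `Δ = none`. -/
def Mark.pos : Mark E → Option E := Sum.elim (fun p => some p.2) (fun _ => none)

open Classical in
/-- The pure jump process: `X_s = E_0` if `s ≤ T_1`, `X_s = E_n` if `T_n < s ≤ T_{n+1}`, and
`X_s = Δ` if `s` is not reached by the jump times. -/
def X (s : ℝ) (ω : ℕ → Mark E) : Option E :=
  if h : ∃ n, (s : EReal) ≤ (ω (n + 1)).time then (ω (Nat.find h)).pos else none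

end Law

/-! ### The control problem -/

section Control

variable {E A : Type*} [MeasurableSpace E] [MeasurableSpace A]

/-- Feedback control laws: Borel maps `α(t, x)`. Only `t ∈ [0, T]` matters for the gain. -/
def Admissible (E A : Type*) [MeasurableSpace E] [MeasurableSpace A] : Type _ :=
  {α : ℝ × E → A // Measurable α}

/-- The controlled rate transition measure `ν^α(t, x, dy) = κ(x, α(t, x), dy)`. -/
def controlledRate (κ : Kernel (E × A) E) (α : Admissible E A) : Kernel (ℝ × E) E :=
  κ.comap (fun p => (p.2, α.1 p)) (measurable_snd.prodMk α.2)

instance (κ : Kernel (E × A) E) [IsFiniteKernel κ] (α : Admissible E A) :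
    IsFiniteKernel (controlledRate κ α) := by
  unfold controlledRate; infer_instance

/-- The law `P^{t,x}_α`. -/
def controlledLaw (κ : Kernel (E × A) E) [IsFiniteKernel κ] (α : Admissible E A) (t : ℝ) (x : E) :
    Measure (ℕ → Mark E) :=
  jumpLaw (controlledRate κ α) t (Measure.dirac x)

/-- The random gain `∫_t^T f(s, X_s, α(s, X_s)) ds + g(X_T)`; functions are extended by `0` to the
cemetery `Δ`. -/
def reward (T : ℝ) (f : ℝ → E → A → ℝ) (g : E → ℝ) (α : Admissible E A) (t : ℝ)
    (ω : ℕ → Mark E) : ℝ :=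
  (∫ s in t..T, (X s ω).elim 0 fun y => f s y (α.1 (s, y))) + (X T ω).elim 0 g

/-- The gain functional `J(t, x, α)`. -/
def gain (T : ℝ) (κ : Kernel (E × A) E) [IsFiniteKernel κ] (f : ℝ → E → A → ℝ) (g : E → ℝ)
    (t : ℝ) (x : E) (α : Admissible E A) : ℝ :=
  ∫ ω, reward T f g α t ω ∂(controlledLaw κ α t x)

/-- The value function `V(t, x) = sup_α J(t, x, α)`. -/
def value (T : ℝ) (κ : Kernel (E × A) E) [IsFiniteKernel κ] (f : ℝ → E → A → ℝ) (g : E → ℝ)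
    (t : ℝ) (x : E) : ℝ :=
  ⨆ α : Admissible E A, gain T κ f g t x α

end Control

/-! ### The Hamilton-Jacobi-Bellman equation -/

section HJB

variable {E A : Type*} [MeasurableSpace E] [MeasurableSpace A]

/-- `L^a_E φ(x) = ∫_E (φ(y) - φ(x)) κ(x, a, dy)`. -/
def generator (κ : Kernel (E × A) E) (a : A) (φ : E → ℝ) (x : E) : ℝ :=
  ∫ y, (φ y - φ x) ∂(κ (x, a))

/-- `sup_{a ∈ A} (L^a_E v(t, x) + f(t, x, a))`. -/
def hamiltonian (κ : Kernel (E × A) E) (f : ℝ → E → A → ℝ) (v : ℝ → E → ℝ) (t : ℝ) (x : E) : ℝ :=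
  ⨆ a : A, (generator κ a (v t) x + f t x a)

/-- `v`, as a function on `[0, T] × E`, is a solution of the HJB equation. -/
structure IsHJBSolution (T : ℝ) (κ : Kernel (E × A) E) (f : ℝ → E → A → ℝ) (g : E → ℝ)
    (v : ℝ → E → ℝ) : Prop where
  measurable : Measurable fun p : Icc (0 : ℝ) T × E => v p.1 p.2
  bounded : ∃ C, ∀ t ∈ Icc 0 T, ∀ x, |v t x| ≤ C
  measurable_rhs : Measurable fun p : Icc (0 : ℝ) T × E => hamiltonian κ f v p.1 p.2
  terminal : ∀ x, v T x = g x
  absolutelyContinuous : ∀ x, AbsolutelyContinuousOnInterval (fun t => v t x) 0 T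
  equation : ∀ x, ∀ᵐ t ∂(volume.restrict (Icc 0 T)),
    HasDerivAt (fun s => v s x) (-hamiltonian κ f v t x) t

/-- `φ ∈ LSC_b(S)` for a subset `S` of a topological space: the restriction of `φ` to `S` is lower
semicontinuous and bounded. -/
def IsLSCb {Z : Type*} [TopologicalSpace Z] (φ : Z → ℝ) (S : Set Z) : Prop :=
  LowerSemicontinuousOn φ S ∧ ∃ C, ∀ z ∈ S, |φ z| ≤ C

/-- The Feller property: `(x, a) ↦ ∫ φ(y) κ(x, a, dy)` is continuous for every `φ ∈ C_b(E)`. -/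
def IsFeller [TopologicalSpace E] [TopologicalSpace A] (κ : Kernel (E × A) E) : Prop :=
  ∀ φ : E → ℝ, Continuous φ → (∃ C, ∀ y, |φ y| ≤ C) →
    Continuous fun p : E × A => ∫ y, φ y ∂(κ p)

end HJB

end PureJump

end

noncomputable section

namespace PureJump

/-! ### Lower semicontinuity of parametric integrals -/

/-! Existence comes from uniformization. Fix `Λ` above all jump rates and give `κ (x, a)` an extra
atom at `x`, so that every measure has mass `Λ`. The zero-order term of the generator is then `-Λ v`
whatever the action, so it leaves the supremum (`generator_add_eq`, `hamiltonian_eq`), and with the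
integrating factor `exp (-Λ t)` the HJB equation integrates to the fixed-point equation `bellman v =
v`. The operator is monotone, and adding a constant `d ≥ 0` to its argument raises the result by at
most `(1 - exp (-Λ T)) d`: it is a contraction over the whole horizon at once (`bellman_le_add`). It
also preserves bounded lower semicontinuous functions, by the Feller property and because suprema of
lower semicontinuous functions are lower semicontinuous; this is also why the Hamiltonian is Borel.
Picard iterates converge uniformly, hence their limit stays in the class
(`exists_bddLSC_bellman_eq`), and it solves the equation (`isHJBSolution_of_bellman_eq`).

Uniqueness and `v = V` both follow from a verification argument valid for every bounded lower
semicontinuous solution (`IsHJBSolution.eq_value`). For a fixed control, a solution of the HJB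
equation is a supersolution of the linear Kolmogorov equation. Let `M n` be the gain collected up to
the `n`-th jump plus the value of `v` at the `n`-th mark, the latter counted only before `T`.
Integrating the derivative of survival function times remaining value along one sojourn shows that
the mean of `M n` does not increase (`integral_survivalReal_le`,
`IsSupersolution.integral_step_le`). The probability of `n` jumps before `T` decays geometrically,
so `M n` is eventually the total gain, and dominated convergence gives `J ≤ v`
(`IsSupersolution.integral_pathGain_le`).

For the converse, lower semicontinuity in the action lets a countable dense set of actions supply an
`ε`-optimal Borel feedback (`exists_measurable_hamiltonian_lt`). Under it `-v + ε (T - t)` is a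
supersolution for the negated gains, so the same theorem yields `J ≥ v - ε T`. -/

lemma IsLusinSpace.isSeparable_metrizable {S : Type*} [TopologicalSpace S] (h : IsLusinSpace S) :
    TopologicalSpace.MetrizableSpace S ∧ SecondCountableTopology S := by
  obtain ⟨K, _, _, i, hi, -⟩ := h
  exact ⟨hi.metrizableSpace, hi.secondCountableTopology⟩

section InfConvolution

variable {Z : Type*} [PseudoMetricSpace Z] {φ : Z → ℝ} {C : ℝ}

/-- The Lipschitz regularization `z ↦ inf_w (φ w + n d(z, w))` of a bounded function. -/
def infConvolution (φ : Z → ℝ) (n : ℕ) (z : Z) : ℝ := ⨅ w, (φ w + n * dist z w)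

lemma bddBelow_infConvolution (hC : ∀ z, |φ z| ≤ C) (n : ℕ) (z : Z) :
    BddBelow (range fun w => φ w + n * dist z w) := by
  refine ⟨-C, ?_⟩
  rintro _ ⟨w, rfl⟩
  have := neg_le_of_abs_le (hC w)
  have : 0 ≤ (n : ℝ) * dist z w := by positivity
  dsimp only
  linarith

lemma infConvolution_le (hC : ∀ z, |φ z| ≤ C) (n : ℕ) (z : Z) : infConvolution φ n z ≤ φ z :=
  (ciInf_le (bddBelow_infConvolution hC n z) z).trans (by simp)

lemma abs_infConvolution_le (hC : ∀ z, |φ z| ≤ C) (n : ℕ) (z : Z) :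
    |infConvolution φ n z| ≤ C := by
  have : Nonempty Z := ⟨z⟩
  refine abs_le.2 ⟨le_ciInf fun w => ?_, (infConvolution_le hC n z).trans (le_of_abs_le (hC z))⟩
  have := neg_le_of_abs_le (hC w)
  have : 0 ≤ (n : ℝ) * dist z w := by positivity
  linarith

lemma lipschitzWith_infConvolution (hC : ∀ z, |φ z| ≤ C) (n : ℕ) :
    LipschitzWith n (infConvolution φ n) := by
  refine LipschitzWith.of_le_add_mul _ fun x y => ?_
  have : Nonempty Z := ⟨x⟩
  rw [← sub_le_iff_le_add]
  refine le_ciInf fun w => ?_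
  have h1 := ciInf_le (bddBelow_infConvolution hC n x) w
  have h2 : (n : ℝ) * dist x w ≤ n * (dist x y + dist y w) := by
    gcongr; exact dist_triangle _ _ _
  simp only [infConvolution, NNReal.coe_natCast]
  linarith

lemma tendsto_infConvolution (hφ : LowerSemicontinuous φ) (hC : ∀ z, |φ z| ≤ C) (z : Z) :
    Tendsto (fun n => infConvolution φ n z) atTop (𝓝 (φ z)) := by
  have : Nonempty Z := ⟨z⟩
  refine tendsto_order.2 ⟨fun y hy => ?_, fun y hy =>
    Eventually.of_forall fun n => (infConvolution_le hC n z).trans_lt hy⟩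
  obtain ⟨y', hyy', hy'⟩ := exists_between hy
  obtain ⟨δ, hδ, hball⟩ := Metric.eventually_nhds_iff.1 (hφ z y' hy')
  -- Points within `δ` of `z` already have `φ` above `y'`; farther away `φ ≥ -C`, and `N` makes the
  -- penalty `N δ` at least `y' + C`.
  obtain ⟨N, hN⟩ := exists_nat_ge ((y' + C) / δ)
  filter_upwards [eventually_ge_atTop N] with n hn
  refine hyy'.trans_le (le_ciInf fun w => ?_)
  rcases lt_or_ge (dist w z) δ with hw | hw
  · have := hball hw
    have : 0 ≤ (n : ℝ) * dist z w := by positivity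
    linarith
  · have h1 : y' + C ≤ N * δ := (div_le_iff₀ hδ).1 hN
    have h2 : (N : ℝ) * δ ≤ n * dist z w := by
      rw [dist_comm z w]
      have : (N : ℝ) ≤ n := by exact_mod_cast hn
      gcongr
    have := neg_le_of_abs_le (hC w)
    linarith

end InfConvolution

/-- The inf-convolutions increase to `φ`, so the integral of `φ` is a supremum of continuous
functions of `p`. Testing on Lipschitz `ψ` suffices, and this matters: in the applications one
coordinate of `Z` moves with `p`, and the Lipschitz constant controls that motion uniformly in the
other coordinate. -/
lemma lowerSemicontinuous_integral_of_lipschitz {P Z : Type*} [TopologicalSpace P]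
    [PseudoMetricSpace Z] [MeasurableSpace Z] [OpensMeasurableSpace Z]
    (μ : P → Measure Z) [∀ p, IsFiniteMeasure (μ p)]
    (hμ : ∀ (ψ : Z → ℝ) (K : ℝ≥0) (C : ℝ), LipschitzWith K ψ → (∀ z, |ψ z| ≤ C) →
      Continuous fun p => ∫ z, ψ z ∂(μ p))
    {φ : Z → ℝ} {C : ℝ} (hφ : LowerSemicontinuous φ) (hC : ∀ z, |φ z| ≤ C) :
    LowerSemicontinuous fun p => ∫ z, φ z ∂(μ p) := by
  have hi : ∀ n p, Integrable (infConvolution φ n) (μ p) := fun n p =>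
    Integrable.of_bound (lipschitzWith_infConvolution hC n).continuous.measurable.aestronglyMeasurable
      C (ae_of_all _ fun z => abs_infConvolution_le hC n z)
  have hi' : ∀ p, Integrable φ (μ p) := fun p =>
    Integrable.of_bound hφ.measurable.aestronglyMeasurable C (ae_of_all _ fun z => hC z)
  intro p y hy
  have hlim : Tendsto (fun n => ∫ z, infConvolution φ n z ∂(μ p)) atTop (𝓝 (∫ z, φ z ∂(μ p))) :=
    tendsto_integral_of_dominated_convergence (fun _ => C) (fun n => (hi n p).aestronglyMeasurable)
      (integrable_const _) (fun n => ae_of_all _ fun z => abs_infConvolution_le hC n z)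
      (ae_of_all _ fun z => tendsto_infConvolution hφ hC z)
  obtain ⟨n, hn⟩ := (hlim.eventually (lt_mem_nhds hy)).exists
  have hc := hμ _ _ _ (lipschitzWith_infConvolution hC n) (abs_infConvolution_le hC n)
  filter_upwards [hc.continuousAt.eventually (lt_mem_nhds hn)] with q hq
  exact hq.trans_le (integral_mono (hi n q) (hi' q) (infConvolution_le hC n))

lemma lowerSemicontinuous_of_tendsto_of_sub_le {Z : Type*} [TopologicalSpace Z] {u : ℕ → Z → ℝ}
    {v : Z → ℝ} {e : ℕ → ℝ} (hu : ∀ n, LowerSemicontinuous (u n))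
    (he : Tendsto e atTop (𝓝 0)) (huv : ∀ n z, |u n z - v z| ≤ e n) : LowerSemicontinuous v := by
  intro z y hy
  -- The uniform error is spent twice, at `z` and at the nearby point `w`, hence half of the gap.
  obtain ⟨n, hn⟩ := (he.eventually (gt_mem_nhds (half_pos (sub_pos.2 hy)))).exists
  have h1 : y + e n < u n z := by
    have := (abs_le.1 (huv n z)).1
    linarith
  filter_upwards [hu n z _ h1] with w hw
  have := (abs_le.1 (huv n w)).2
  linarith

lemma abs_ciSup_le {ι : Type*} [Nonempty ι] {u : ι → ℝ} {C : ℝ} (hu : ∀ i, |u i| ≤ C) :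
    |⨆ i, u i| ≤ C := by
  have hb : BddAbove (range u) := ⟨C, by rintro _ ⟨i, rfl⟩; exact le_of_abs_le (hu i)⟩
  obtain ⟨i⟩ := ‹Nonempty ι›
  exact abs_le.2 ⟨(neg_le_of_abs_le (hu i)).trans (le_ciSup hb i),
    ciSup_le fun i => le_of_abs_le (hu i)⟩

lemma ciSup_le_ciSup_add {ι : Type*} [Nonempty ι] {u w : ι → ℝ} {d : ℝ}
    (hw : BddAbove (range w)) (h : ∀ i, u i ≤ w i + d) : ⨆ i, u i ≤ (⨆ i, w i) + d :=
  ciSup_le fun i => (h i).trans (by gcongr; exact le_ciSup hw i)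

lemma ciSup_add_const {ι : Type*} [Nonempty ι] {u : ι → ℝ} (hu : BddAbove (range u)) (d : ℝ) :
    ⨆ i, (u i + d) = (⨆ i, u i) + d := by
  obtain ⟨B, hB⟩ := hu
  refine le_antisymm (ciSup_le_ciSup_add ⟨B, hB⟩ fun i => le_rfl) ?_
  have hb : BddAbove (range fun i => u i + d) :=
    ⟨B + d, by rintro _ ⟨i, rfl⟩; simpa using hB ⟨i, rfl⟩⟩
  linarith [ciSup_le_ciSup_add (u := u) (d := -d) hb fun i => by simp]

/-! ### Bounded lower semicontinuous functions -/

/-- Bounded lower semicontinuous real functions. -/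
def BddLSC {Z : Type*} [TopologicalSpace Z] (φ : Z → ℝ) : Prop :=
  LowerSemicontinuous φ ∧ ∃ C, ∀ z, |φ z| ≤ C

namespace BddLSC

variable {Z : Type*} [TopologicalSpace Z] {φ ψ : Z → ℝ}

lemma add (hφ : BddLSC φ) (hψ : BddLSC ψ) : BddLSC fun z => φ z + ψ z := by
  obtain ⟨h1, C, hC⟩ := hφ
  obtain ⟨h2, D, hD⟩ := hψ
  exact ⟨h1.add h2, C + D, fun z => (abs_add_le _ _).trans (add_le_add (hC z) (hD z))⟩

lemma comp {Y : Type*} [TopologicalSpace Y] (hφ : BddLSC φ) {i : Y → Z} (hi : Continuous i) :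
    BddLSC fun y => φ (i y) :=
  ⟨hφ.1.comp hi, hφ.2.imp fun _ hC y => hC (i y)⟩

/-- Dividing by the positive factor turns `y < c w * φ w` into `y / c w < φ w`, whose left side is
continuous; a value `m` strictly in between separates the two. -/
lemma mul_of_pos {c : Z → ℝ} (hφ : BddLSC φ) (hc : Continuous c) (hpos : ∀ z, 0 < c z)
    {D : ℝ} (hD : ∀ z, c z ≤ D) : BddLSC fun z => c z * φ z := by
  obtain ⟨h1, C, hC⟩ := hφ
  refine ⟨fun z y hy => ?_, D * C, fun z => ?_⟩
  · have h2 : y / c z < φ z := (div_lt_iff₀' (hpos z)).2 hy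
    obtain ⟨m, hm1, hm2⟩ := exists_between h2
    have h3 : Continuous fun w => y / c w := continuous_const.div hc fun w => (hpos w).ne'
    filter_upwards [h1 z m hm2, h3.continuousAt.eventually (gt_mem_nhds hm1)] with w hw1 hw2
    exact (div_lt_iff₀' (hpos w)).1 (hw2.trans hw1)
  · rw [abs_mul, abs_of_pos (hpos z)]
    exact mul_le_mul (hD z) (hC z) (abs_nonneg _) ((hpos z).le.trans (hD z))

lemma ciSup {ι : Type*} [Nonempty ι] [TopologicalSpace ι] {u : Z × ι → ℝ} (hu : BddLSC u) :
    BddLSC fun z => ⨆ i, u (z, i) := by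
  obtain ⟨h1, C, hC⟩ := hu
  refine ⟨lowerSemicontinuous_ciSup (fun z => ⟨C, ?_⟩) fun i => h1.comp (by fun_prop),
    C, fun z => abs_ciSup_le fun i => hC _⟩
  rintro _ ⟨i, rfl⟩
  exact le_of_abs_le (hC _)

end BddLSC

/-! ### The dynamic programming operator -/

section Operator

variable {E A : Type*} [MeasurableSpace E] [MeasurableSpace A]

/-- The measure `κ(x, a, dy) + (Λ - κ(x, a, E)) δ_x(dy)`. -/
def uniformized (Λ : ℝ) (κ : Kernel (E × A) E) (p : E × A) : Measure E :=
  κ p + ENNReal.ofReal (Λ - (κ p).real univ) • Measure.dirac p.1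

instance (Λ : ℝ) (κ : Kernel (E × A) E) [IsFiniteKernel κ] (p : E × A) :
    IsFiniteMeasure (uniformized Λ κ p) := by
  have : IsFiniteMeasure (ENNReal.ofReal (Λ - (κ p).real univ) • (Measure.dirac p.1 : Measure E)) :=
    Measure.smul_finite _ ENNReal.ofReal_ne_top
  unfold uniformized; infer_instance

variable {Λ : ℝ} {κ : Kernel (E × A) E} [IsFiniteKernel κ]

lemma integral_uniformized (hΛ : ∀ p, (κ p).real univ ≤ Λ) (p : E × A) {φ : E → ℝ}
    (hφ : Measurable φ) {C : ℝ} (hC : ∀ y, |φ y| ≤ C) :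
    ∫ y, φ y ∂(uniformized Λ κ p) = ∫ y, φ y ∂(κ p) + (Λ - (κ p).real univ) * φ p.1 := by
  have hb : ∀ (μ : Measure E) [IsFiniteMeasure μ], Integrable φ μ := fun μ _ =>
    Integrable.of_bound hφ.aestronglyMeasurable C (ae_of_all _ fun z => hC z)
  have : IsFiniteMeasure (ENNReal.ofReal (Λ - (κ p).real univ) • (Measure.dirac p.1 : Measure E)) :=
    Measure.smul_finite _ ENNReal.ofReal_ne_top
  rw [uniformized, integral_add_measure (hb _) (hb _), integral_smul_measure,
    integral_dirac' _ _ hφ.stronglyMeasurable, ENNReal.toReal_ofReal (sub_nonneg.2 (hΛ p)),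
    smul_eq_mul]

lemma uniformized_real_univ (hΛ : ∀ p, (κ p).real univ ≤ Λ) (p : E × A) :
    (uniformized Λ κ p).real univ = Λ := by
  have := integral_uniformized hΛ p (φ := fun _ => 1) measurable_const (C := 1) (by simp)
  simpa using this

variable [TopologicalSpace E] [BorelSpace E] [TopologicalSpace.MetrizableSpace E]
  [SecondCountableTopology E] [TopologicalSpace A]

lemma BddLSC.measurable {Z : Type*} [TopologicalSpace Z] [MeasurableSpace Z]
    [OpensMeasurableSpace Z] {φ : Z → ℝ} (h : BddLSC φ) : Measurable φ := h.1.measurable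

/-- The Feller property only concerns functions of `y`, while here the integrand also moves with
time. The measures are pushed onto `{t} × E`; for a Lipschitz `ψ`, moving `t` costs at most `K Λ |t
- t'|` because the mass is `Λ`, and with `t` frozen the Feller property applies. -/
lemma BddLSC.integral_uniformized (hκ : IsFeller κ) (hΛ : ∀ p, (κ p).real univ ≤ Λ)
    {v : ℝ × E → ℝ} (hv : BddLSC v) :
    BddLSC fun z : (ℝ × E) × A => ∫ y, v (z.1.1, y) ∂(uniformized Λ κ (z.1.2, z.2)) := by
  let := TopologicalSpace.metrizableSpaceMetric E
  obtain ⟨h1, C, hC⟩ := hv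
  have hn : ∀ s p, |∫ y, v (s, y) ∂(uniformized Λ κ p)| ≤ C * Λ := fun s p => by
    have := norm_integral_le_of_norm_le_const (μ := uniformized Λ κ p)
      (ae_of_all _ fun y => (Real.norm_eq_abs _).trans_le (hC (s, y)))
    rwa [uniformized_real_univ hΛ, Real.norm_eq_abs] at this
  refine ⟨?_, C * Λ, fun z => hn _ _⟩
  have hm : ∀ s : ℝ, Measurable fun y : E => (s, y) := fun s => by fun_prop
  let μ : (ℝ × E) × A → Measure (ℝ × E) := fun z =>
    (uniformized Λ κ (z.1.2, z.2)).map fun y => (z.1.1, y)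
  have hμ : ∀ z {φ : ℝ × E → ℝ}, Measurable φ →
      ∫ w, φ w ∂(μ z) = ∫ y, φ (z.1.1, y) ∂(uniformized Λ κ (z.1.2, z.2)) := fun z φ hφ =>
    integral_map (hm _).aemeasurable hφ.aestronglyMeasurable
  have : ∀ z, IsFiniteMeasure (μ z) := fun z => by dsimp only [μ]; infer_instance
  suffices h : LowerSemicontinuous fun z => ∫ w, v w ∂(μ z) by
    simpa only [hμ _ h1.measurable] using h
  refine lowerSemicontinuous_integral_of_lipschitz μ (fun ψ K D hK hD => ?_) h1 hC
  simp only [hμ _ hK.continuous.measurable]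
  have hi : ∀ s p, Integrable (fun y => ψ (s, y)) (uniformized Λ κ p) := fun s p =>
    Integrable.of_bound (hK.continuous.measurable.comp (hm s)).aestronglyMeasurable D
      (ae_of_all _ fun y => hD _)
  have hc : ∀ s : ℝ, Continuous fun p => ∫ y, ψ (s, y) ∂(uniformized Λ κ p) := fun s => by
    have hs : Continuous fun y => ψ (s, y) := hK.continuous.comp (by fun_prop)
    -- The test function `1` shows that the total rate is continuous, hence so is the weight of the
    -- atom.
    have h1 := hκ _ continuous_const ⟨1, fun y : E => (abs_one (α := ℝ)).le⟩
    simp only [integral_const, smul_eq_mul, mul_one] at h1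
    simp only [fun p => PureJump.integral_uniformized hΛ p hs.measurable fun y => hD (s, y)]
    exact (hκ _ hs ⟨D, fun y => hD _⟩).add
      ((continuous_const.sub h1).mul (hs.comp continuous_fst))
  refine continuous_iff_continuousAt.2 fun z => ?_
  have hlim1 : Tendsto (fun w : (ℝ × E) × A => ∫ y, ψ (z.1.1, y) ∂(uniformized Λ κ (w.1.2, w.2)))
      (𝓝 z) (𝓝 (∫ y, ψ (z.1.1, y) ∂(uniformized Λ κ (z.1.2, z.2)))) :=
    ((hc z.1.1).comp (by fun_prop : Continuous fun w : (ℝ × E) × A => (w.1.2, w.2))).continuousAt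
  have hlim2 : Tendsto (fun w : (ℝ × E) × A => K * dist w.1.1 z.1.1 * Λ) (𝓝 z) (𝓝 0) := by
    have : Continuous fun w : (ℝ × E) × A => K * dist w.1.1 z.1.1 * Λ := by fun_prop
    simpa using this.tendsto z
  have hlim3 : Tendsto (fun w : (ℝ × E) × A =>
      ∫ y, ψ (w.1.1, y) ∂(uniformized Λ κ (w.1.2, w.2)) -
        ∫ y, ψ (z.1.1, y) ∂(uniformized Λ κ (w.1.2, w.2))) (𝓝 z) (𝓝 0) := by
    refine squeeze_zero_norm (fun w => ?_) hlim2
    rw [← integral_sub (hi _ _) (hi _ _)]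
    have h := norm_integral_le_of_norm_le_const (μ := uniformized Λ κ (w.1.2, w.2))
      (f := fun y => ψ (w.1.1, y) - ψ (z.1.1, y)) (C := K * dist w.1.1 z.1.1)
      (ae_of_all _ fun y => by
        have := hK.dist_le_mul (w.1.1, y) (z.1.1, y)
        rwa [Prod.dist_eq, dist_self, max_eq_left dist_nonneg, dist_eq_norm (ψ _)] at this)
    rwa [uniformized_real_univ hΛ] at h
  have := hlim3.add hlim1
  simpa [ContinuousAt] using this

/-- `sup_a (∫ v(t, y) κ'(x, a, dy) + f(t, x, a))` for the uniformized kernel `κ'`. -/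
def uniformizedHamiltonian (Λ : ℝ) (κ : Kernel (E × A) E) (f : (ℝ × E) × A → ℝ) (v : ℝ × E → ℝ)
    (z : ℝ × E) : ℝ :=
  ⨆ a, (∫ y, v (z.1, y) ∂(uniformized Λ κ (z.2, a)) + f (z, a))

lemma BddLSC.uniformizedHamiltonian [Nonempty A] {v : ℝ × E → ℝ} (hv : BddLSC v)
    (hκ : IsFeller κ) (hΛ : ∀ p, (κ p).real univ ≤ Λ) {f : (ℝ × E) × A → ℝ} (hf : BddLSC f) : BddLSC (uniformizedHamiltonian Λ κ f v) :=
  ((hv.integral_uniformized hκ hΛ).add hf).ciSup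

/-- All uniformized measures have mass exactly `Λ`, so the constant `d` contributes `d * Λ` for
every action. -/
lemma uniformizedHamiltonian_le_add [Nonempty A] (hκ : IsFeller κ)
    (hΛ : ∀ p, (κ p).real univ ≤ Λ) {f : (ℝ × E) × A → ℝ} (hf : BddLSC f) {v w : ℝ × E → ℝ}
    (hv : BddLSC v) (hw : BddLSC w) {d : ℝ} (hd : ∀ z, v z ≤ w z + d) (z : ℝ × E) :
    uniformizedHamiltonian Λ κ f v z ≤ uniformizedHamiltonian Λ κ f w z + d * Λ := by
  obtain ⟨-, B, hB⟩ := (hw.integral_uniformized hκ hΛ).add hf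
  refine ciSup_le_ciSup_add ⟨B, ?_⟩ fun a => ?_
  · rintro _ ⟨a, rfl⟩
    exact le_of_abs_le (hB (z, a))
  · have hi : ∀ {u : ℝ × E → ℝ}, BddLSC u →
        Integrable (fun y => u (z.1, y)) (uniformized Λ κ (z.2, a)) := fun hu =>
      Integrable.of_bound (hu.comp (by fun_prop)).measurable.aestronglyMeasurable _
        (ae_of_all _ fun y => hu.2.choose_spec _)
    have h := integral_mono (hi hv) ((hi hw).add (integrable_const d)) fun y => hd (z.1, y)
    simp only [Pi.add_apply] at h
    rw [integral_add (hi hw) (integrable_const d), integral_const, uniformized_real_univ hΛ,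
      smul_eq_mul, mul_comm Λ] at h
    linarith

end Operator

/-! ### Extending functions from `[0, T]` to all times -/

/-- The projection of the real line onto `[0, T]`. -/
def clamp (T t : ℝ) : ℝ := max 0 (min T t)

lemma continuous_clamp (T : ℝ) : Continuous (clamp T) := by unfold clamp; fun_prop

lemma clamp_nonneg (T t : ℝ) : 0 ≤ clamp T t := le_max_left _ _

lemma clamp_le {T : ℝ} (hT : 0 ≤ T) (t : ℝ) : clamp T t ≤ T := max_le hT (min_le_left _ _)

lemma clamp_of_mem {T t : ℝ} (ht : t ∈ Icc 0 T) : clamp T t = t := by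
  rw [clamp, min_eq_right ht.2, max_eq_right ht.1]

/-- Same scheme as for the kernel: Lebesgue measure on `(clamp T t, T]` is carried to the fibre over
`x`. For Lipschitz `ψ`, moving `x` costs at most `K T dist x x'`, and with `x` frozen the integral
is continuous in its lower endpoint. -/
lemma BddLSC.intervalIntegral_clamp {E : Type*} [TopologicalSpace E] [MeasurableSpace E]
    [BorelSpace E] [TopologicalSpace.MetrizableSpace E] [SecondCountableTopology E]
    {T : ℝ} (hT : 0 ≤ T) {φ : ℝ × E → ℝ} (hφ : BddLSC φ) :
    BddLSC fun z : ℝ × E => ∫ s in clamp T z.1..T, φ (s, z.2) := by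
  let := TopologicalSpace.metrizableSpaceMetric E
  obtain ⟨h1, C, hC⟩ := hφ
  refine ⟨?_, C * T, fun z => ?_⟩
  swap
  · have hC0 : 0 ≤ C := (abs_nonneg _).trans (hC z)
    have h := intervalIntegral.norm_integral_le_of_norm_le_const (a := clamp T z.1) (b := T)
      (f := fun s => φ (s, z.2)) (C := C) fun s _ => hC _
    refine h.trans ?_
    rw [abs_of_nonneg (sub_nonneg.2 (clamp_le hT _))]
    gcongr
    linarith [clamp_nonneg T z.1]
  let μ : ℝ × E → Measure (ℝ × E) := fun z =>
    (volume.restrict (Ioc (clamp T z.1) T)).map fun s => (s, z.2)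
  have hm : ∀ x : E, Measurable fun s : ℝ => (s, x) := fun s => by fun_prop
  have hμ : ∀ z {φ : ℝ × E → ℝ}, Measurable φ →
      ∫ w, φ w ∂(μ z) = ∫ s in clamp T z.1..T, φ (s, z.2) := fun z φ hφ => by
    rw [intervalIntegral.integral_of_le (clamp_le hT _)]
    exact integral_map (hm _).aemeasurable hφ.aestronglyMeasurable
  have : ∀ z, IsFiniteMeasure (μ z) := fun z => by dsimp only [μ]; infer_instance
  suffices h : LowerSemicontinuous fun z => ∫ w, φ w ∂(μ z) by
    simpa only [hμ _ h1.measurable] using h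
  refine lowerSemicontinuous_integral_of_lipschitz μ (fun ψ K D hK hD => ?_) h1 hC
  simp only [hμ _ hK.continuous.measurable]
  have hi : ∀ x a b, IntervalIntegrable (fun s => ψ (s, x)) volume a b := fun x a b =>
    (hK.continuous.comp (by fun_prop)).intervalIntegrable _ _
  refine continuous_iff_continuousAt.2 fun z => ?_
  have hlim1 : Tendsto (fun w : ℝ × E => ∫ s in clamp T w.1..T, ψ (s, z.2))
      (𝓝 z) (𝓝 (∫ s in clamp T z.1..T, ψ (s, z.2))) := by
    have h : Continuous fun r => ∫ s in r..T, ψ (s, z.2) := by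
      simp only [intervalIntegral.integral_symm T]
      exact (intervalIntegral.continuous_primitive (hi z.2) T).neg
    exact (h.comp ((continuous_clamp T).comp continuous_fst)).continuousAt
  have hlim2 : Tendsto (fun w : ℝ × E => K * dist w.2 z.2 * T) (𝓝 z) (𝓝 0) := by
    have : Continuous fun w : ℝ × E => K * dist w.2 z.2 * T := by fun_prop
    simpa using this.tendsto z
  have hlim3 : Tendsto (fun w : ℝ × E => (∫ s in clamp T w.1..T, ψ (s, w.2)) -
      ∫ s in clamp T w.1..T, ψ (s, z.2)) (𝓝 z) (𝓝 0) := by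
    refine squeeze_zero_norm (fun w => ?_) hlim2
    rw [← intervalIntegral.integral_sub (hi _ _ _) (hi _ _ _)]
    have h := intervalIntegral.norm_integral_le_of_norm_le_const (a := clamp T w.1) (b := T)
      (f := fun s => ψ (s, w.2) - ψ (s, z.2)) (C := K * dist w.2 z.2) fun s _ => by
        have := hK.dist_le_mul (s, w.2) (s, z.2)
        rwa [Prod.dist_eq, dist_self, max_eq_right dist_nonneg, dist_eq_norm (ψ _)] at this
    refine h.trans ?_
    rw [abs_of_nonneg (sub_nonneg.2 (clamp_le hT _))]
    gcongr
    linarith [clamp_nonneg T w.1]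
  have := hlim3.add hlim1
  simpa [ContinuousAt] using this

/-! ### The dynamic programming operator as a contraction -/

section Bellman

variable {E A : Type*} [MeasurableSpace E] [MeasurableSpace A]

/-- The dynamic programming operator. -/
def bellman (Λ T : ℝ) (κ : Kernel (E × A) E) (f : (ℝ × E) × A → ℝ) (g : E → ℝ) (v : ℝ × E → ℝ)
    (z : ℝ × E) : ℝ :=
  Real.exp (Λ * clamp T z.1) * (Real.exp (-(Λ * T)) * g z.2 +
    ∫ s in clamp T z.1..T, Real.exp (-(Λ * clamp T s)) * uniformizedHamiltonian Λ κ f v (s, z.2))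

variable {Λ T : ℝ} {κ : Kernel (E × A) E} [IsFiniteKernel κ] [TopologicalSpace E] [BorelSpace E]
  [TopologicalSpace.MetrizableSpace E] [SecondCountableTopology E] [TopologicalSpace A]
  [Nonempty A] {f : (ℝ × E) × A → ℝ} {g : E → ℝ} {v w : ℝ × E → ℝ}

lemma BddLSC.exp_mul_uniformizedHamiltonian (hv : BddLSC v) (hκ : IsFeller κ) (hΛ0 : 0 ≤ Λ)
    (hΛ : ∀ p, (κ p).real univ ≤ Λ) (hf : BddLSC f) :
    BddLSC fun z : ℝ × E =>
      Real.exp (-(Λ * clamp T z.1)) * PureJump.uniformizedHamiltonian Λ κ f v z :=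
  (hv.uniformizedHamiltonian hκ hΛ hf).mul_of_pos
    (Real.continuous_exp.comp (continuous_const.mul ((continuous_clamp T).comp continuous_fst)).neg)
    (fun _ => Real.exp_pos _) fun _ => Real.exp_le_one_iff.2
      (neg_nonpos.2 (mul_nonneg hΛ0 (clamp_nonneg _ _)))

lemma BddLSC.bellman (hv : BddLSC v) (hκ : IsFeller κ) (hΛ0 : 0 ≤ Λ)
    (hΛ : ∀ p, (κ p).real univ ≤ Λ) (hT : 0 ≤ T) (hf : BddLSC f) (hg : BddLSC g) :
    BddLSC (bellman Λ T κ f g v) := by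
  refine mul_of_pos (D := Real.exp (Λ * T)) (add ?_ ?_)
    (Real.continuous_exp.comp (continuous_const.mul ((continuous_clamp T).comp continuous_fst)))
    (fun _ => Real.exp_pos _) fun z => ?_
  · exact (hg.comp continuous_snd).mul_of_pos continuous_const (fun _ => Real.exp_pos _)
      fun _ => le_rfl
  · exact (hv.exp_mul_uniformizedHamiltonian hκ hΛ0 hΛ hf).intervalIntegral_clamp hT
  · gcongr
    exact clamp_le hT _

/-- The factor comes from `exp (Λ c) * ∫ s in c..T, Λ exp (-Λ s) = 1 - exp (-Λ (T - c))`, largest at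
`c = 0`. It is below `1` for every `T`, so the horizon need not be cut into short intervals. -/
lemma bellman_le_add (hκ : IsFeller κ) (hΛ0 : 0 ≤ Λ) (hΛ : ∀ p, (κ p).real univ ≤ Λ)
    (hT : 0 ≤ T) (hf : BddLSC f) (hv : BddLSC v) (hw : BddLSC w) {d : ℝ} (hd0 : 0 ≤ d)
    (hd : ∀ z, v z ≤ w z + d) (z : ℝ × E) :
    bellman Λ T κ f g v z ≤ bellman Λ T κ f g w z + (1 - Real.exp (-(Λ * T))) * d := by
  set c := clamp T z.1 with hc
  have hcT : c ≤ T := clamp_le hT _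
  have hc0 : 0 ≤ c := clamp_nonneg _ _
  have hi : ∀ {u : ℝ × E → ℝ}, BddLSC u → IntervalIntegrable (fun s =>
      Real.exp (-(Λ * clamp T s)) * uniformizedHamiltonian Λ κ f u (s, z.2)) volume c T :=
    fun hu => by
      have h := (hu.exp_mul_uniformizedHamiltonian (T := T) hκ hΛ0 hΛ hf).comp
        (by fun_prop : Continuous fun s : ℝ => (s, z.2))
      exact (intervalIntegrable_const (c := h.2.choose)).mono_fun h.measurable.aestronglyMeasurable
        (ae_of_all _ fun s => (h.2.choose_spec s).trans (le_abs_self _))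
  have hder : ∀ s ∈ uIcc c T, HasDerivAt (fun s => -(d * Real.exp (-(Λ * s))))
      (Real.exp (-(Λ * s)) * (d * Λ)) s := fun s _ => by
    have h := ((((hasDerivAt_id s).const_mul Λ).neg.exp).const_mul d).neg
    refine h.congr_deriv ?_
    simp only [id, mul_one, Pi.neg_apply]
    ring
  have hexpi : IntervalIntegrable (fun s => Real.exp (-(Λ * s)) * (d * Λ)) volume c T :=
    Continuous.intervalIntegrable (by fun_prop) _ _
  have hexp : ∫ s in c..T, Real.exp (-(Λ * s)) * (d * Λ) =
      d * Real.exp (-(Λ * c)) - d * Real.exp (-(Λ * T)) := by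
    rw [intervalIntegral.integral_eq_sub_of_hasDerivAt hder hexpi]
    ring
  have hint := intervalIntegral.integral_mono_on hcT (hi hv) ((hi hw).add hexpi) fun s hs => by
    have h := uniformizedHamiltonian_le_add hκ hΛ hf hv hw hd (s, z.2)
    rw [clamp_of_mem ⟨hc0.trans hs.1, hs.2⟩]
    have := mul_le_mul_of_nonneg_left h (Real.exp_pos (-(Λ * s))).le
    linarith
  rw [intervalIntegral.integral_add (hi hw) hexpi, hexp] at hint
  have hmul := mul_le_mul_of_nonneg_left hint (Real.exp_pos (Λ * c)).le
  have h1 : Real.exp (Λ * c) * Real.exp (-(Λ * c)) = 1 := by rw [← Real.exp_add]; simp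
  have h2 : Real.exp (-(Λ * T)) ≤ Real.exp (Λ * c) * Real.exp (-(Λ * T)) :=
    le_mul_of_one_le_left (Real.exp_pos _).le (Real.one_le_exp (by positivity))
  have h3 := mul_le_mul_of_nonneg_left h2 hd0
  simp only [bellman, ← hc]
  linear_combination hmul + h3 + d * h1

/-- Picard iteration started from `0`. The geometric error bound is uniform in `z`, which is what
carries lower semicontinuity to the limit. -/
lemma exists_bddLSC_bellman_eq (hκ : IsFeller κ) (hΛ0 : 0 ≤ Λ) (hΛ : ∀ p, (κ p).real univ ≤ Λ)
    (hT : 0 ≤ T) (hf : BddLSC f) (hg : BddLSC g) :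
    ∃ v : ℝ × E → ℝ, BddLSC v ∧ bellman Λ T κ f g v = v := by
  set Γ := bellman Λ T κ f g with hΓ
  set θ := 1 - Real.exp (-(Λ * T)) with hθ
  have hθ0 : 0 ≤ θ := sub_nonneg.2 (Real.exp_le_one_iff.2 (by
    have := mul_nonneg hΛ0 hT
    linarith))
  have hθ1 : θ < 1 := sub_lt_self _ (Real.exp_pos _)
  have hcontr : ∀ {v w : ℝ × E → ℝ}, BddLSC v → BddLSC w → ∀ {d : ℝ}, 0 ≤ d →
      (∀ z, |v z - w z| ≤ d) → ∀ z, |Γ v z - Γ w z| ≤ θ * d := by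
    intro v w hv hw d hd0 hd z
    have h1 := bellman_le_add (g := g) hκ hΛ0 hΛ hT hf hv hw hd0
      (fun z => by linarith [(abs_le.1 (hd z)).2]) z
    have h2 := bellman_le_add (g := g) hκ hΛ0 hΛ hT hf hw hv hd0
      (fun z => by linarith [(abs_le.1 (hd z)).1]) z
    exact abs_le.2 ⟨by linarith, by linarith⟩
  let u : ℕ → ℝ × E → ℝ := fun n => Γ^[n] fun _ => 0
  have hsucc : ∀ n, u (n + 1) = Γ (u n) := fun n => Function.iterate_succ_apply' _ _ _
  have hu : ∀ n, BddLSC (u n) := fun n => by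
    induction n with
    | zero => exact ⟨lowerSemicontinuous_const, 0, fun z => by simp [u]⟩
    | succ n ih => rw [hsucc]; exact ih.bellman hκ hΛ0 hΛ hT hf hg
  obtain ⟨C, hC⟩ := (hu 1).2
  -- A point is needed only to see that the bound `C` is nonnegative.
  by_cases hne : Nonempty (ℝ × E)
  swap
  · exact ⟨u 0, hu 0, funext fun z => (hne ⟨z⟩).elim⟩
  have hC0 : 0 ≤ C := (abs_nonneg _).trans (hC hne.some)
  have hstep : ∀ n z, |u n z - u (n + 1) z| ≤ C * θ ^ n := fun n => by
    induction n with
    | zero => intro z; simpa [u] using hC z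
    | succ n ih =>
      intro z
      rw [hsucc (n + 1), hsucc n]
      have := hcontr (hu n) (hu (n + 1)) (by positivity) ih z
      rw [← hsucc n] at this ⊢
      rw [pow_succ]
      linarith
  have hcauchy : ∀ z, CauchySeq fun n => u n z := fun z =>
    cauchySeq_of_le_geometric θ C hθ1 fun n => hstep n z
  choose v hv using fun z => cauchySeq_tendsto_of_complete (hcauchy z)
  have herr : ∀ n z, |u n z - v z| ≤ C * θ ^ n / (1 - θ) := fun n z =>
    dist_le_of_le_geometric_of_tendsto θ C hθ1 (fun n => hstep n z) (hv z) n
  have hlim : Tendsto (fun n => C * θ ^ n / (1 - θ)) atTop (𝓝 0) := by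
    simpa using ((tendsto_pow_atTop_nhds_zero_of_lt_one hθ0 hθ1).const_mul C).div_const (1 - θ)
  have hvL : BddLSC v := by
    refine ⟨lowerSemicontinuous_of_tendsto_of_sub_le (fun n => (hu n).1) hlim herr,
      C * θ ^ 0 / (1 - θ), fun z => ?_⟩
    simpa [u] using herr 0 z
  refine ⟨v, hvL, funext fun z => ?_⟩
  -- `u (n + 1) z` tends to `v z`, and by the contraction estimate also to `Γ v z`.
  refine tendsto_nhds_unique ?_ ((tendsto_add_atTop_iff_nat 1).2 (hv z))
  have h1 : Tendsto (fun n => u (n + 1) z - Γ v z) atTop (𝓝 0) := by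
    refine squeeze_zero_norm (fun n => ?_) (by simpa using hlim.const_mul θ)
    rw [hsucc]
    exact hcontr (hu n) hvL (div_nonneg (by positivity) (sub_nonneg.2 hθ1.le)) (herr n) z
  simpa using h1.add_const (Γ v z)

end Bellman

/-! ### From the fixed point to the HJB equation; nearly optimal controls -/

lemma absolutelyContinuousOnInterval_congr {φ ψ : ℝ → ℝ} {a b : ℝ}
    (hφ : AbsolutelyContinuousOnInterval φ a b) (h : EqOn φ ψ (uIcc a b)) :
    AbsolutelyContinuousOnInterval ψ a b := by
  rw [absolutelyContinuousOnInterval_iff] at hφ ⊢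
  refine fun ε hε => (hφ ε hε).imp fun δ hδ => ⟨hδ.1, fun I hI hlt => ?_⟩
  convert! hδ.2 I hI hlt using 1
  refine Finset.sum_congr rfl fun i hi => ?_
  rw [h (hI.1 i hi).1, h (hI.1 i hi).2]

section

variable {E A : Type*} [MeasurableSpace E] [MeasurableSpace A] {Λ T : ℝ} {κ : Kernel (E × A) E}
  [IsFiniteKernel κ]

lemma generator_eq_integral_sub {φ : E → ℝ} (hφ : Measurable φ) {C : ℝ} (hC : ∀ y, |φ y| ≤ C)
    (a : A) (x : E) :
    generator κ a φ x = ∫ y, φ y ∂(κ (x, a)) - (κ (x, a)).real univ * φ x := by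
  rw [generator, integral_sub (Integrable.of_bound hφ.aestronglyMeasurable C
    (ae_of_all _ fun y => hC y)) (integrable_const _)]
  simp

variable [TopologicalSpace E] [BorelSpace E] {v : ℝ × E → ℝ}

/-- The atom adds `(Λ - κ (x, a) univ) * v (t, x)`, which completes the action-dependent loss term
to `Λ * v (t, x)`. -/
lemma generator_add_eq (hΛ : ∀ p, (κ p).real univ ≤ Λ) (hv : BddLSC v)
    (t : ℝ) (x : E) (a : A) (b : ℝ) :
    generator κ a (fun y => v (t, y)) x + b =
      (∫ y, v (t, y) ∂(uniformized Λ κ (x, a)) + b) + -(Λ * v (t, x)) := by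
  have hm : BddLSC fun y => v (t, y) := hv.comp (by fun_prop)
  obtain ⟨C, hC⟩ := hm.2
  rw [generator_eq_integral_sub hm.measurable hC, integral_uniformized hΛ _ hm.measurable hC]
  ring

variable [TopologicalSpace.MetrizableSpace E] [SecondCountableTopology E] [TopologicalSpace A]
  {f : ℝ → E → A → ℝ} {fe : (ℝ × E) × A → ℝ} {g : E → ℝ}

lemma hamiltonian_eq [Nonempty A] (hκ : IsFeller κ) (hΛ : ∀ p, (κ p).real univ ≤ Λ)
    (hf : BddLSC fe) (hv : BddLSC v) {t : ℝ} {x : E} (hft : ∀ a, f t x a = fe ((t, x), a)) :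
    hamiltonian κ f (fun t x => v (t, x)) t x =
      uniformizedHamiltonian Λ κ fe v (t, x) + -(Λ * v (t, x)) := by
  obtain ⟨-, B, hB⟩ := (hv.integral_uniformized hκ hΛ).add hf
  rw [uniformizedHamiltonian, ← ciSup_add_const]
  · exact iSup_congr fun a => by rw [hft, generator_add_eq hΛ hv]
  · refine ⟨B, ?_⟩
    rintro _ ⟨a, rfl⟩
    exact le_of_abs_le (hB ((t, x), a))

/-- On `[0, T]` the fixed-point identity writes `v (·, x)` as a smooth factor times the primitive of
a bounded function. It is therefore absolutely continuous, and Lebesgue differentiation gives the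
equation almost everywhere. -/
lemma isHJBSolution_of_bellman_eq [Nonempty A] (hκ : IsFeller κ) (hΛ0 : 0 ≤ Λ)
    (hΛ : ∀ p, (κ p).real univ ≤ Λ) (hT : 0 < T) (hf : BddLSC fe)
    (hft : ∀ t ∈ Icc 0 T, ∀ x a, f t x a = fe ((t, x), a)) (hv : BddLSC v)
    (hfix : bellman Λ T κ fe g v = v) : IsHJBSolution T κ f g fun t x => v (t, x) := by
  have hi : ∀ x : E, IntervalIntegrable (fun s =>
      Real.exp (-(Λ * clamp T s)) * uniformizedHamiltonian Λ κ fe v (s, x)) volume 0 T :=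
    fun x => by
      have h := (hv.exp_mul_uniformizedHamiltonian (T := T) hκ hΛ0 hΛ hf).comp
        (by fun_prop : Continuous fun s : ℝ => (s, x))
      exact (intervalIntegrable_const (c := h.2.choose)).mono_fun h.measurable.aestronglyMeasurable
        (ae_of_all _ fun s => (h.2.choose_spec s).trans (le_abs_self _))
  have hformula : ∀ x, ∀ t ∈ Icc 0 T, v (t, x) = Real.exp (Λ * t) * (Real.exp (-(Λ * T)) * g x -
      ∫ s in T..t, Real.exp (-(Λ * clamp T s)) * uniformizedHamiltonian Λ κ fe v (s, x)) := by
    intro x t ht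
    conv_lhs => rw [← hfix, bellman]
    simp only [clamp_of_mem ht]
    rw [intervalIntegral.integral_symm t T, sub_eq_add_neg, neg_neg]
  have hT' : T ∈ uIcc 0 T := right_mem_uIcc
  refine ⟨?_, ?_, ?_, fun x => ?_, fun x => ?_, fun x => ?_⟩
  · exact hv.measurable.comp (by fun_prop : Measurable fun p : Icc (0 : ℝ) T × E => (p.1.1, p.2))
  · exact hv.2.imp fun C hC t _ x => hC _
  · have : (fun p : Icc (0 : ℝ) T × E => hamiltonian κ f (fun t x => v (t, x)) p.1 p.2) =
        fun p : Icc (0 : ℝ) T × E => uniformizedHamiltonian Λ κ fe v (p.1.1, p.2) +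
          -(Λ * v (p.1.1, p.2)) :=
      funext fun p => hamiltonian_eq hκ hΛ hf hv fun a => hft _ p.1.2 _ _
    rw [this]
    have hm : Measurable fun p : Icc (0 : ℝ) T × E => (p.1.1, p.2) := by fun_prop
    exact ((hv.uniformizedHamiltonian hκ hΛ hf).measurable.comp hm).add
      ((hv.measurable.comp hm).const_mul Λ).neg
  · rw [hformula x T ⟨hT.le, le_rfl⟩, intervalIntegral.integral_same, sub_zero, ← mul_assoc,
      ← Real.exp_add]
    simp
  · have h1 : AbsolutelyContinuousOnInterval (fun t => Real.exp (Λ * t)) 0 T :=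
      ContDiffOn.absolutelyContinuousOnInterval (by fun_prop)
    have h2 := ((hi x).absolutelyContinuousOnInterval_intervalIntegral hT').neg
    have h3 : AbsolutelyContinuousOnInterval (fun _ : ℝ => Real.exp (-(Λ * T)) * g x) 0 T :=
      ContDiffOn.absolutelyContinuousOnInterval (by fun_prop)
    refine absolutelyContinuousOnInterval_congr (h1.mul (h3.add h2)) fun t ht => ?_
    rw [uIcc_of_le hT.le] at ht
    rw [hformula x t ht, sub_eq_add_neg]
    rfl
  -- The derivative is two-sided but the formula holds only on `[0, T]`, so the two endpoints are
  -- discarded as a null set.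
  · rw [← restrict_Ioo_eq_restrict_Icc, ae_restrict_iff' measurableSet_Ioo]
    filter_upwards [(hi x).ae_hasDerivAt_integral] with t ht htT
    have htI : t ∈ Icc 0 T := Ioo_subset_Icc_self htT
    have h1 := ht (by rwa [uIcc_of_le hT.le]) T hT'
    have h2 : HasDerivAt (fun t => Real.exp (Λ * t)) (Real.exp (Λ * t) * (Λ * 1)) t :=
      ((hasDerivAt_id t).const_mul Λ).exp
    have h3 := h2.mul (h1.const_sub (Real.exp (-(Λ * T)) * g x))
    have h4 : HasDerivAt (fun s => v (s, x)) _ t := h3.congr_of_eventuallyEq (by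
      filter_upwards [Icc_mem_nhds htT.1 htT.2] with s hs using hformula x s hs)
    refine h4.congr_deriv ?_
    rw [hamiltonian_eq hκ hΛ hf hv fun a => hft t htI x a, hformula x t htI, clamp_of_mem htI]
    have h5 : Real.exp (Λ * t) * Real.exp (-(Λ * t)) = 1 := by rw [← Real.exp_add]; simp
    linear_combination -(uniformizedHamiltonian Λ κ fe v (t, x)) * h5

/-- Existence of `ε`-optimal feedback controls. -/
lemma exists_measurable_hamiltonian_lt [Nonempty A] [SecondCountableTopology A] (hκ : IsFeller κ)
    (hΛ : ∀ p, (κ p).real univ ≤ Λ) (hf : BddLSC fe) (hv : BddLSC v) {ε : ℝ} (hε : 0 < ε) :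
    ∃ α : Admissible E A, ∀ z, uniformizedHamiltonian Λ κ fe v z - ε <
      ∫ y, v (z.1, y) ∂(uniformized Λ κ (z.2, α.1 z)) + fe (z, α.1 z) := by
  have hF := (hv.integral_uniformized hκ hΛ).add hf
  set F : (ℝ × E) × A → ℝ := fun p =>
    ∫ y, v (p.1.1, y) ∂(uniformized Λ κ (p.1.2, p.2)) + fe p with hFdef
  have hH := hv.uniformizedHamiltonian hκ hΛ hf
  have hex : ∀ z, ∃ n, uniformizedHamiltonian Λ κ fe v z - ε <
      F (z, TopologicalSpace.denseSeq A n) := fun z => by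
    obtain ⟨a, ha⟩ := exists_lt_of_lt_ciSup (f := fun a => F (z, a))
      (sub_lt_self (uniformizedHamiltonian Λ κ fe v z) hε)
    -- The superlevel set is open and nonempty, so it meets the dense sequence. The least index that
    -- works is measurable in `z`, which replaces a measurable selection theorem.
    have hz : LowerSemicontinuous fun a => F (z, a) := hF.1.comp (by fun_prop)
    exact (TopologicalSpace.denseRange_denseSeq A).exists_mem_open (hz.isOpen_preimage _)
      ⟨a, ha⟩
  classical
  have hmeas : Measurable fun z => Nat.find (hex z) :=
    measurable_find hex fun n => measurableSet_lt (hH.measurable.sub_const ε)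
      (hF.comp (by fun_prop : Continuous fun z => (z, TopologicalSpace.denseSeq A n))).measurable
  exact ⟨⟨fun z => TopologicalSpace.denseSeq A (Nat.find (hex z)),
    (measurable_of_countable _).comp hmeas⟩, fun z => Nat.find_spec (hex z)⟩

end

/-! ### Absolutely continuous supersolutions along one sojourn -/

section Sojourn

variable {q : ℝ → ℝ} {Λ : ℝ}

lemma intervalIntegrable_of_abs_le {φ : ℝ → ℝ} (hφ : Measurable φ) {C : ℝ} (hC : ∀ r, |φ r| ≤ C)
    (a b : ℝ) : IntervalIntegrable φ volume a b :=
  (intervalIntegrable_const (c := C)).mono_fun hφ.aestronglyMeasurable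
    (ae_of_all _ fun s => (hC s).trans (le_abs_self _))

lemma abs_exp_neg_sub_exp_neg_le {a b : ℝ} (ha : 0 ≤ a) (hb : 0 ≤ b) :
    |Real.exp (-a) - Real.exp (-b)| ≤ |a - b| := by
  wlog hab : a ≤ b generalizing a b
  · rw [abs_sub_comm, abs_sub_comm a]
    exact this hb ha (le_of_not_ge hab)
  have h1 : Real.exp (-b) ≤ Real.exp (-a) := Real.exp_le_exp.2 (by linarith)
  rw [abs_of_nonneg (by linarith), abs_of_nonpos (by linarith)]
  have h2 := Real.add_one_le_exp (a - b)
  have h3 : Real.exp (-a) ≤ 1 := Real.exp_le_one_iff.2 (by linarith)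
  have h4 : Real.exp (-b) = Real.exp (-a) * Real.exp (a - b) := by rw [← Real.exp_add]; ring_nf
  have h5 := mul_le_mul_of_nonneg_left h2 (Real.exp_pos (-a)).le
  have h6 := mul_le_mul_of_nonneg_right h3 (sub_nonneg.2 hab)
  rw [h4]
  linarith

/-- The survival function `exp (- ∫_s^r q)`. -/
def survivalReal (q : ℝ → ℝ) (s r : ℝ) : ℝ := Real.exp (-∫ u in s..r, q u)

lemma survivalReal_self (s : ℝ) : survivalReal q s s = 1 := by simp [survivalReal]

lemma survivalReal_pos (s r : ℝ) : 0 < survivalReal q s r := Real.exp_pos _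

/-- The integrated rate is nonnegative and `Λ`-Lipschitz, and `exp (-·)` is `1`-Lipschitz on
nonnegative reals. -/
lemma absolutelyContinuousOnInterval_survivalReal (hqm : Measurable q) (hq0 : ∀ u, 0 ≤ q u)
    (hqΛ : ∀ u, q u ≤ Λ) {s b : ℝ} (hsb : s ≤ b) :
    AbsolutelyContinuousOnInterval (survivalReal q s) s b := by
  have hqa : ∀ u, |q u| ≤ Λ := fun u => by rw [abs_of_nonneg (hq0 u)]; exact hqΛ u
  have hi := intervalIntegrable_of_abs_le hqm hqa
  refine LipschitzOnWith.absolutelyContinuousOnInterval (K := Λ.toNNReal)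
    (LipschitzOnWith.of_dist_le_mul fun x hx y hy => ?_)
  rw [uIcc_of_le hsb] at hx hy
  have h0 : ∀ x ∈ Icc s b, 0 ≤ ∫ u in s..x, q u := fun x hx =>
    intervalIntegral.integral_nonneg hx.1 fun u _ => hq0 u
  rw [Real.coe_toNNReal _ ((hq0 0).trans (hqΛ 0))]
  refine (abs_exp_neg_sub_exp_neg_le (h0 x hx) (h0 y hy)).trans ?_
  rw [intervalIntegral.integral_interval_sub_left (hi _ _) (hi _ _)]
  exact intervalIntegral.norm_integral_le_of_norm_le_const (f := q) fun u _ => hqa u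

lemma ae_hasDerivAt_survivalReal (hqm : Measurable q) (hqa : ∀ u, |q u| ≤ Λ) {s b : ℝ} :
    ∀ᵐ r, r ∈ uIcc s b → HasDerivAt (survivalReal q s) (-(survivalReal q s r * q r)) r := by
  filter_upwards [(intervalIntegrable_of_abs_le hqm hqa s b).ae_hasDerivAt_integral] with r hr hrs
  have h := (hr hrs s left_mem_uIcc).neg.exp
  exact h.congr_deriv (by simp [survivalReal])

lemma integral_survivalReal_mul (hqm : Measurable q) (hq0 : ∀ u, 0 ≤ q u) (hqΛ : ∀ u, q u ≤ Λ)
    {s b : ℝ} (hsb : s ≤ b) :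
    ∫ r in s..b, survivalReal q s r * q r = 1 - survivalReal q s b := by
  have hqa : ∀ u, |q u| ≤ Λ := fun u => by rw [abs_of_nonneg (hq0 u)]; exact hqΛ u
  have h := (absolutelyContinuousOnInterval_survivalReal hqm hq0 hqΛ hsb).integral_deriv_eq_sub
  have h2 : ∫ r in s..b, deriv (survivalReal q s) r = ∫ r in s..b, -(survivalReal q s r * q r) :=
    intervalIntegral.integral_congr_ae (by
      filter_upwards [ae_hasDerivAt_survivalReal hqm hqa] with r hr hrs
        using (hr (uIoc_subset_uIcc hrs)).deriv)
  rw [h2, intervalIntegral.integral_neg, survivalReal_self] at h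
  linarith

lemma exp_neg_le_survivalReal (hqa : ∀ u, |q u| ≤ Λ) {s b : ℝ}
    (hsb : s ≤ b) : Real.exp (-(Λ * (b - s))) ≤ survivalReal q s b := by
  refine Real.exp_le_exp.2 (neg_le_neg ?_)
  have h := intervalIntegral.norm_integral_le_of_norm_le_const (a := s) (b := b)
    (f := q) (C := Λ) fun u _ => hqa u
  rw [abs_of_nonneg (sub_nonneg.2 hsb)] at h
  exact (le_abs_self _).trans h

/-- With `S` the survival function and `F r = ∫ z in s..r, h z`, consider `Θ = S * (u + F - a)`. In
the bound for its derivative the terms in `q * u` and `h` cancel, leaving `Θ' ≤ -S * (q * (F - a) +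
w)` almost everywhere. Moreover `Θ s = u s - a`, and `a` is exactly the value for which `Θ b = 0`.
All factors are absolutely continuous, so integrating `Θ'` gives the claim. -/
lemma integral_survivalReal_le (hqm : Measurable q) (hq0 : ∀ u, 0 ≤ q u) (hqΛ : ∀ u, q u ≤ Λ)
    {s b : ℝ} (hsb : s ≤ b) {h w u : ℝ → ℝ} (hhm : Measurable h) (hwm : Measurable w)
    {C : ℝ} (hhC : ∀ r, |h r| ≤ C) (hwC : ∀ r, |w r| ≤ C)
    (hu : AbsolutelyContinuousOnInterval u s b)
    (hder : ∀ᵐ r, r ∈ Icc s b → ∃ d, HasDerivAt u d r ∧ d ≤ -(w r - q r * u r) - h r) {a : ℝ}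
    (ha : a = (∫ r in s..b, h r) + u b) :
    a + ∫ r in s..b, survivalReal q s r * (q r * ((∫ z in s..r, h z) - a) + w r) ≤ u s := by
  have hqa : ∀ u, |q u| ≤ Λ := fun u => by rw [abs_of_nonneg (hq0 u)]; exact hqΛ u
  have hSac := absolutelyContinuousOnInterval_survivalReal hqm hq0 hqΛ hsb
  have hhi := intervalIntegrable_of_abs_le hhm hhC
  have hFac := (hhi s b).absolutelyContinuousOnInterval_intervalIntegral left_mem_uIcc
  have hca : AbsolutelyContinuousOnInterval (fun _ : ℝ => -a) s b :=
    ContDiffOn.absolutelyContinuousOnInterval (by fun_prop)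
  have hΘ := hSac.mul ((hu.add hFac).add hca)
  have hFTC := hΘ.integral_deriv_eq_sub
  have hFc : Continuous fun r => ∫ z in s..r, h z := intervalIntegral.continuous_primitive hhi s
  have hint : IntervalIntegrable
      (fun r => -(survivalReal q s r * (q r * ((∫ z in s..r, h z) - a) + w r))) volume s b :=
    ((((intervalIntegrable_of_abs_le hqm hqa s b).mul_continuousOn
      (hFc.sub continuous_const).continuousOn).add
      (intervalIntegrable_of_abs_le hwm hwC s b)).continuousOn_mul hSac.continuousOn).neg
  have hle := intervalIntegral.integral_mono_ae_restrict hsb hΘ.intervalIntegrable_deriv hint (by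
    rw [EventuallyLE, ae_restrict_iff' measurableSet_Icc]
    have hI : uIcc s b = Icc s b := uIcc_of_le hsb
    filter_upwards [ae_hasDerivAt_survivalReal hqm hqa (s := s) (b := b),
      (hhi s b).ae_hasDerivAt_integral, hder] with r hr1 hr2 hr3 hrI
    obtain ⟨d, hd, hdle⟩ := hr3 hrI
    have hd' := (hr1 (hI ▸ hrI)).mul
      ((hd.add (hr2 (hI ▸ hrI) s left_mem_uIcc)).add (hasDerivAt_const r (-a)))
    rw [hd'.deriv]
    simp only [Pi.add_apply]
    have := mul_le_mul_of_nonneg_left hdle (survivalReal_pos (q := q) s r).le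
    linarith)
  rw [hFTC, intervalIntegral.integral_neg] at hle
  simp only [Pi.mul_apply, Pi.add_apply, survivalReal_self, intervalIntegral.integral_same] at hle
  have h0 : u b + (∫ r in s..b, h r) + -a = 0 := by rw [ha]; ring
  rw [h0] at hle
  linarith

end Sojourn

/-! ### One step of the jump chain -/

section OneStep

variable {E : Type*} [MeasurableSpace E] (ν : Kernel (ℝ × E) E)

/-- The total jump rate. -/
def jumpRate (e : E) (u : ℝ) : ℝ := (ν (u, e)).real univ

lemma measurable_jumpRate (e : E) : Measurable (jumpRate ν e) :=
  ((Kernel.measurable_coe ν MeasurableSet.univ).comp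
    (by fun_prop : Measurable fun u : ℝ => (u, e))).ennreal_toReal

lemma jumpRate_nonneg (e : E) (u : ℝ) : 0 ≤ jumpRate ν e u := measureReal_nonneg

lemma survival_eq (s : ℝ) (e : E) {r : ℝ} (hr : s < r) :
    (survival ν (s, e) r : ℝ) = survivalReal (jumpRate ν e) s r := by
  rw [survival, indicator_of_mem (by exact hr), Real.coe_toNNReal _ (Real.exp_pos _).le]
  rfl

variable [IsFiniteKernel ν]

lemma jumpRate_le (e : E) (u : ℝ) : jumpRate ν e u ≤ ν.bound.toReal :=
  ENNReal.toReal_mono ν.bound_ne_top (ν.measure_le_bound _ _)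

instance (p : ℝ × E) : IsFiniteMeasure (finiteJump ν p) :=
  ⟨(finiteJump_univ_le_one ν p).trans_lt ENNReal.one_lt_top⟩

lemma integral_finiteJump (s : ℝ) (e : E) {Φ : ℝ × E → ℝ} (hΦ : Measurable Φ) {C : ℝ}
    (hC : ∀ z, |Φ z| ≤ C) :
    ∫ z, Φ z ∂(finiteJump ν (s, e)) =
      ∫ r in Ioi s, survivalReal (jumpRate ν e) s r * ∫ y, Φ (r, y) ∂(ν (r, e)) := by
  have hi : Integrable Φ (finiteJump ν (s, e)) :=
    Integrable.of_bound hΦ.aestronglyMeasurable C (ae_of_all _ hC)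
  rw [finiteJump] at hi ⊢
  rw [integral_compProd hi]
  simp only [Kernel.comap_apply]
  rw [Kernel.integral_withDensity (measurable_survival ν), Kernel.const_apply,
    ← integral_indicator measurableSet_Ioi]
  refine integral_congr_ae (ae_of_all _ fun r => ?_)
  by_cases hr : r ∈ Ioi s
  · simp only [indicator_of_mem hr, NNReal.smul_def, survival_eq ν s e hr, smul_eq_mul]
  · have : survival ν (s, e) r = 0 := indicator_of_notMem hr _
    simp [indicator_of_notMem hr, this]

/-- The cemetery carries the missing mass, so subtracting the value there leaves an integral against
`finiteJump` alone and the missing mass never has to be computed. -/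
lemma integral_jumpKernel_inl (p : ℝ × E) {ψ : Mark E → ℝ} (hψ : Measurable ψ) {C : ℝ}
    (hC : ∀ m, |ψ m| ≤ C) :
    ∫ m, ψ m ∂(jumpKernel ν (Sum.inl p)) =
      ψ (Sum.inr ()) + ∫ z, (ψ (Sum.inl z) - ψ (Sum.inr ())) ∂(finiteJump ν p) := by
  have hb : ∀ (μ : Measure (Mark E)) [IsFiniteMeasure μ], Integrable ψ μ := fun μ _ =>
    Integrable.of_bound hψ.aestronglyMeasurable C (ae_of_all _ hC)
  have hi : Integrable (fun z => ψ (Sum.inl z)) (finiteJump ν p) :=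
    Integrable.of_bound (hψ.comp measurable_inl).aestronglyMeasurable C (ae_of_all _ fun z => hC _)
  have hle := finiteJump_univ_le_one ν p
  change ∫ m, ψ m ∂((finiteJump ν p).map Sum.inl +
      (1 - finiteJump ν p univ) • Measure.dirac (Sum.inr ()) : Measure (Mark E)) = _
  have hfin : IsFiniteMeasure
      ((1 - finiteJump ν p univ) • Measure.dirac (Sum.inr ()) : Measure (Mark E)) :=
    Measure.smul_finite _ (ENNReal.sub_ne_top ENNReal.one_ne_top)
  rw [integral_add_measure (hb _) (hb _), integral_map measurable_inl.aemeasurable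
    hψ.aestronglyMeasurable, integral_smul_measure, integral_dirac' _ _ hψ.stronglyMeasurable,
    ENNReal.toReal_sub_of_le hle ENNReal.one_ne_top, integral_sub hi (integrable_const _),
    integral_const, smul_eq_mul, smul_eq_mul, measureReal_def, ENNReal.toReal_one]
  ring

/-- The expectation of a function which, unless the next jump occurs before `T`, is constant. -/
lemma integral_jumpKernel_before {s T : ℝ} (hsT : s ≤ T) (e : E) {B : ℝ × E → ℝ} (hB : Measurable B)
    {C : ℝ} (hC : ∀ z, |B z| ≤ C) (a : ℝ) :
    ∫ m, Sum.elim (fun z : ℝ × E => if z.1 < T then B z else a) (fun _ => a) m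
        ∂(jumpKernel ν (Sum.inl (s, e))) =
      a + ∫ r in s..T, survivalReal (jumpRate ν e) s r *
        (∫ y, B (r, y) ∂(ν (r, e)) - jumpRate ν e r * a) := by
  have hlt : MeasurableSet {z : ℝ × E | z.1 < T} := measurableSet_lt (by fun_prop) (by fun_prop)
  have hm : Measurable (Sum.elim (fun z : ℝ × E => if z.1 < T then B z else a) (fun _ => a) :
      Mark E → ℝ) :=
    (Measurable.ite hlt hB measurable_const).sumElim measurable_const
  have hC0 : ∀ z : ℝ × E, |if z.1 < T then B z else a| ≤ max C |a| := fun z => by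
    split_ifs
    exacts [(hC z).trans (le_max_left _ _), le_max_right _ _]
  rw [integral_jumpKernel_inl ν _ hm (C := max C |a|)]
  swap
  · rintro (z | _)
    exacts [hC0 z, le_max_right _ _]
  simp only [Sum.elim_inl, Sum.elim_inr]
  congr 1
  -- After subtracting `a` the integrand vanishes for `r ≥ T`, which cuts the half-line down to `(s,
  -- T)`.
  rw [integral_finiteJump ν s e (Φ := fun z => (if z.1 < T then B z else a) - a) ((Measurable.ite hlt hB measurable_const).sub measurable_const)
    (C := max C |a| + |a|) fun z => (abs_sub _ _).trans (by gcongr; exact hC0 z),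
    intervalIntegral.integral_of_le hsT, integral_Ioc_eq_integral_Ioo, ← Ioi_inter_Iio,
    ← setIntegral_indicator measurableSet_Iio]
  refine integral_congr_ae (ae_of_all _ fun r => ?_)
  by_cases hr : r < T
  · have hBi : Integrable (fun y => B (r, y)) (ν (r, e)) :=
      Integrable.of_bound (hB.comp measurable_prodMk_left).aestronglyMeasurable C
        (ae_of_all _ fun y => hC _)
    simp only [hr, if_true, indicator_of_mem (show r ∈ Iio T from hr)]
    rw [integral_sub hBi (integrable_const _), integral_const, smul_eq_mul]
    rfl
  · simp [hr]

lemma measurable_integral_kernel (e : E) {v : ℝ × E → ℝ} (hv : Measurable v) :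
    Measurable fun r => ∫ y, v (r, y) ∂(ν (r, e)) :=
  (hv.stronglyMeasurable.integral_kernel_prod_right'
    (κ := ν.comap (fun r : ℝ => (r, e)) (by fun_prop))).measurable

/-- The probability that a further jump occurs before `T`. -/
lemma integral_jumpKernel_lt_le {s T : ℝ} (hs : 0 ≤ s) (hsT : s ≤ T) (e : E) :
    ∫ m, Sum.elim (fun z : ℝ × E => if z.1 < T then (1 : ℝ) else 0) (fun _ => 0) m
        ∂(jumpKernel ν (Sum.inl (s, e))) ≤ 1 - Real.exp (-(ν.bound.toReal * T)) := by
  rw [integral_jumpKernel_before ν hsT e (B := fun _ => 1) measurable_const (C := 1) (by simp) 0]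
  simp only [integral_const, smul_eq_mul, mul_one, mul_zero, sub_zero, zero_add]
  have h := integral_survivalReal_mul (measurable_jumpRate ν e) (jumpRate_nonneg ν e)
    (jumpRate_le ν e) hsT
  have h2 := exp_neg_le_survivalReal (q := jumpRate ν e) (fun u => by
    rw [abs_of_nonneg (jumpRate_nonneg ν e u)]; exact jumpRate_le ν e u) hsT
  have h3 : Real.exp (-(ν.bound.toReal * T)) ≤ Real.exp (-(ν.bound.toReal * (T - s))) := by
    have : 0 ≤ ν.bound.toReal * s := mul_nonneg ENNReal.toReal_nonneg hs
    exact Real.exp_le_exp.2 (by linarith)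
  change ∫ r in s..T, survivalReal (jumpRate ν e) s r * jumpRate ν e r ≤ _
  linarith

end OneStep

lemma measurable_intervalIntegral {Y : Type*} [MeasurableSpace Y] {F : Y × ℝ → ℝ}
    (hF : Measurable F) {a b : Y → ℝ} (ha : Measurable a) (hb : Measurable b) :
    Measurable fun y => ∫ u in a y..b y, F (y, u) := by
  have key : ∀ {a b : Y → ℝ}, Measurable a → Measurable b →
      Measurable fun y => ∫ u in Ioc (a y) (b y), F (y, u) := by
    intro a b ha hb
    simp_rw [← integral_indicator measurableSet_Ioc]
    have : Measurable fun z : Y × ℝ => (Ioc (a z.1) (b z.1)).indicator (fun u => F (z.1, u)) z.2 := by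
      simp only [indicator, mem_Ioc]
      exact Measurable.ite ((measurableSet_lt (ha.comp measurable_fst) measurable_snd).inter
        (measurableSet_le measurable_snd (hb.comp measurable_fst))) hF measurable_const
    exact (this.stronglyMeasurable.integral_prod_right' (ν := volume)).measurable
  exact (key ha hb).sub (key hb ha)

/-! ### The gain accumulated along the jump chain -/

section Chain

variable {E : Type*}

/-- The jump time carried by a mark, truncated at `T`. -/
def truncTime (T : ℝ) : Mark E → ℝ := Sum.elim (fun p => min T p.1) fun _ => T

/-- The gain collected between two consecutive jumps, restricted to `[0, T]`. -/
def stepGain (T : ℝ) (h : ℝ × E → ℝ) (g : E → ℝ) (m m' : Mark E) : ℝ :=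
  Sum.elim (fun p : ℝ × E => if p.1 ∈ Ico 0 T then
    (∫ u in p.1..max p.1 (truncTime T m'), h (u, p.2)) + (if T ≤ truncTime T m' then g p.2 else 0)
    else 0) (fun _ => 0) m

/-- The value of a mark, as long as it lies before the horizon. -/
def markValue (T : ℝ) (v : ℝ × E → ℝ) : Mark E → ℝ :=
  Sum.elim (fun p => if p.1 < T then v p else 0) fun _ => 0

/-- Almost sure properties of two consecutive marks. -/
def IsStep (T : ℝ) (m m' : Mark E) : Prop :=
  truncTime T m < truncTime T m' ∨ (truncTime T m = T ∧ truncTime T m' = T)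

variable {T : ℝ} {h : ℝ × E → ℝ} {g : E → ℝ} {v : ℝ × E → ℝ} {C : ℝ}

lemma truncTime_le (m : Mark E) : truncTime T m ≤ T := by
  rcases m with p | _
  exacts [min_le_left _ _, le_rfl]

lemma IsStep.le {m m' : Mark E} (hm : IsStep T m m') : truncTime T m ≤ truncTime T m' := by
  rcases hm with hm | hm
  exacts [hm.le, (hm.1.trans hm.2.symm).le]

/-- The bound holds for all pairs of marks, not only for pairs satisfying `IsStep`: this is the
purpose of the restriction to `Ico 0 T` and of the `max` in `stepGain`. -/
lemma abs_stepGain_le (hh : ∀ z, |h z| ≤ C) (hg : ∀ x, |g x| ≤ C) (hT : 0 ≤ T) (hC : 0 ≤ C)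
    (m m' : Mark E) : |stepGain T h g m m'| ≤ C * T + C := by
  rcases m with p | _
  swap
  · simpa [stepGain] using by positivity
  simp only [stepGain, Sum.elim_inl]
  split_ifs with hp hT'
  · refine (abs_add_le _ _).trans (add_le_add ?_ (hg _))
    have hi := intervalIntegral.norm_integral_le_of_norm_le_const (a := p.1)
      (b := max p.1 (truncTime T m')) (f := fun u => h (u, p.2)) (C := C) fun u _ => hh _
    refine hi.trans (mul_le_mul_of_nonneg_left ?_ hC)
    rw [abs_of_nonneg (sub_nonneg.2 (le_max_left _ _))]
    have := max_le hp.2.le (truncTime_le (T := T) m')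
    linarith [hp.1]
  · rw [add_zero]
    have hi := intervalIntegral.norm_integral_le_of_norm_le_const (a := p.1)
      (b := max p.1 (truncTime T m')) (f := fun u => h (u, p.2)) (C := C) fun u _ => hh _
    refine hi.trans ((mul_le_mul_of_nonneg_left ?_ hC).trans (le_add_of_nonneg_right hC))
    rw [abs_of_nonneg (sub_nonneg.2 (le_max_left _ _))]
    have := max_le hp.2.le (truncTime_le (T := T) m')
    linarith [hp.1]
  · simpa using by positivity

lemma abs_markValue_le (hv : ∀ z, |v z| ≤ C) (hC : 0 ≤ C) (m : Mark E) :
    |markValue T v m| ≤ C := by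
  rcases m with p | _
  · simp only [markValue, Sum.elim_inl]
    split_ifs
    exacts [hv _, by simpa using hC]
  · simpa [markValue] using hC

lemma stepGain_eq_zero {m : Mark E} (hm : truncTime T m = T) (m' : Mark E) :
    stepGain T h g m m' = 0 := by
  rcases m with p | _
  · have hp : T ≤ p.1 := by simpa [truncTime] using hm
    simp [stepGain, hp.not_gt]
  · rfl

lemma markValue_eq_zero {m : Mark E} (hm : truncTime T m = T) : markValue T v m = 0 := by
  rcases m with p | _
  · have hp : T ≤ p.1 := by simpa [truncTime] using hm
    simp [markValue, hp.not_gt]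
  · rfl

/-- The process `X` on the sojourn interval after the `n`-th jump. -/
lemma X_eq_pos [MeasurableSpace E] {ω : ℕ → Mark E} (hω : ∀ n, IsStep T (ω n) (ω (n + 1))) {n : ℕ}
    {s : ℝ} (hn : n = 0 ∨ truncTime T (ω n) < s) (hs : s ≤ truncTime T (ω (n + 1))) :
    X s ω = (ω n).pos := by
  -- Since `s ≤ T`, truncating the jump time at `T` does not affect the comparison with `s`.
  have hiff : ∀ m : Mark E, (s : EReal) ≤ m.time ↔ s ≤ truncTime T m := fun m => by
    have hsT : s ≤ T := hs.trans (truncTime_le _)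
    rcases m with p | _
    · simp [Mark.time, truncTime, hsT]
    · simp [Mark.time, truncTime, hsT]
  have hmono : Monotone fun n => truncTime T (ω n) := monotone_nat_of_le_succ fun n => (hω n).le
  have hex : ∃ n, (s : EReal) ≤ (ω (n + 1)).time := ⟨n, (hiff _).2 hs⟩
  classical
  have hfind : Nat.find hex = n := by
    refine (Nat.find_eq_iff hex).2 ⟨(hiff _).2 hs, fun k hk => ?_⟩
    rw [hiff, not_le]
    -- For `n = 0` no earlier index exists, so no lower bound on `s` is needed; this covers the
    -- starting instant itself.
    rcases hn with rfl | hn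
    · omega
    · exact (hmono (show k + 1 ≤ n by omega)).trans_lt hn
  rw [X, dif_pos hex]
  congr!

/-- The total gain along a path started at `(t, x)` is the sum of the gains between jumps. -/
lemma sum_stepGain [MeasurableSpace E] (hhm : Measurable h) (hh : ∀ z, |h z| ≤ C) {t : ℝ} {x : E}
    (ht0 : 0 ≤ t) (htT : t < T) {ω : ℕ → Mark E} (h0 : ω 0 = Sum.inl (t, x))
    (hω : ∀ n, IsStep T (ω n) (ω (n + 1))) (n : ℕ) :
    IntervalIntegrable (fun s => (X s ω).elim 0 fun y => h (s, y)) volume t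
        (truncTime T (ω n)) ∧
      ∑ k ∈ Finset.range n, stepGain T h g (ω k) (ω (k + 1)) =
        (∫ s in t..truncTime T (ω n), (X s ω).elim 0 fun y => h (s, y)) +
          if T ≤ truncTime T (ω n) then (X T ω).elim 0 g else 0 := by
  have hmono : Monotone fun n => truncTime T (ω n) := monotone_nat_of_le_succ fun n => (hω n).le
  have hτ0 : truncTime T (ω 0) = t := by simp [h0, truncTime, htT.le]
  induction n with
  | zero => simp [hτ0, htT.not_ge]
  | succ n ih =>
    obtain ⟨hi, hsum⟩ := ih
    rw [Finset.sum_range_succ, hsum]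
    rcases (truncTime_le (T := T) (ω n)).lt_or_eq with hlt | heq
    · have hlt' : truncTime T (ω n) < truncTime T (ω (n + 1)) :=
        (hω n).resolve_right fun hc => hlt.ne hc.1
      have htn : t ≤ truncTime T (ω n) := hτ0 ▸ hmono (Nat.zero_le n)
      have hX : ∀ s ∈ Ioc (truncTime T (ω n)) (truncTime T (ω (n + 1))), X s ω = (ω n).pos :=
        fun s hs => X_eq_pos hω (Or.inr hs.1) hs.2
      rcases hm : ω n with p | u
      swap
      · simp [hm, truncTime] at hlt
      have hp : p.1 < T := by simpa [hm, truncTime] using hlt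
      have hτ : truncTime T (ω n) = p.1 := by simp [hm, truncTime, hp.le]
      rw [hτ] at hX hlt' htn hi
      have hpos : Mark.pos (Sum.inl p) = some p.2 := rfl
      simp only [hm, hpos] at hX
      have heq : EqOn (fun s => h (s, p.2)) (fun s => (X s ω).elim 0 fun y => h (s, y))
          (uIoc p.1 (truncTime T (ω (n + 1)))) := fun s hs => by
        rw [uIoc_of_le hlt'.le] at hs
        simp [hX s hs]
      have hi2 : IntervalIntegrable (fun s => (X s ω).elim 0 fun y => h (s, y)) volume p.1
          (truncTime T (ω (n + 1))) :=
        (intervalIntegrable_of_abs_le (hhm.comp measurable_prodMk_right)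
          (fun r => hh (r, p.2)) _ _).congr heq
      have hmem : p.1 ∈ Ico 0 T := ⟨ht0.trans htn, hp⟩
      refine ⟨hi.trans hi2, ?_⟩
      rw [← hm, hτ, if_neg hp.not_ge, add_zero, ← intervalIntegral.integral_add_adjacent_intervals
        hi hi2, ← intervalIntegral.integral_congr_ae (ae_of_all _ heq), hm, stepGain,
        Sum.elim_inl, if_pos hmem, max_eq_right hlt'.le, add_assoc]
      congr 2
      -- The terminal gain is paid by the only step whose interval `(T_n, T_{n+1}]` contains `T`.
      split_ifs with hT
      · rw [hX T ⟨hp, hT⟩]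
        rfl
      · rfl
    · have heq' : truncTime T (ω (n + 1)) = T := 
        le_antisymm (truncTime_le _) (heq.symm.le.trans (hω n).le)
      have hzero := stepGain_eq_zero (h := h) (g := g) heq (ω (n + 1))
      rw [heq] at hi ⊢
      rw [hzero, add_zero, heq']
      exact ⟨hi, rfl⟩

variable [MeasurableSpace E]

lemma measurable_truncTime : Measurable (truncTime T : Mark E → ℝ) :=
  (measurable_const.min measurable_fst).sumElim measurable_const

lemma measurable_markValue (hv : Measurable v) : Measurable (markValue T v) :=
  (Measurable.ite (measurableSet_lt measurable_fst measurable_const) hv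
    measurable_const).sumElim measurable_const

lemma measurable_stepGain (hh : Measurable h) (hg : Measurable g) :
    Measurable fun q : Mark E × Mark E => stepGain T h g q.1 q.2 := by
  have hτ : Measurable fun w : (ℝ × E) × Mark E => truncTime T w.2 :=
    measurable_truncTime.comp measurable_snd
  have h1 : Measurable fun w : (ℝ × E) × Mark E => if w.1.1 ∈ Ico 0 T then
      (∫ u in w.1.1..max w.1.1 (truncTime T w.2), h (u, w.1.2)) +
        (if T ≤ truncTime T w.2 then g w.1.2 else 0) else 0 := by
    refine Measurable.ite ((measurable_fst.comp measurable_fst) measurableSet_Ico) (.add ?_ ?_)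
      measurable_const
    · exact measurable_intervalIntegral (F := fun z : ((ℝ × E) × Mark E) × ℝ => h (z.2, z.1.1.2))
        (hh.comp (by fun_prop)) (by fun_prop)
        ((measurable_fst.comp measurable_fst).max hτ)
    · exact Measurable.ite (measurableSet_le measurable_const hτ)
        (hg.comp (by fun_prop)) measurable_const
  rw [← (MeasurableEquiv.sumProdDistrib (ℝ × E) Unit (Mark E)).symm.measurable_comp_iff]
  convert! h1.sumElim (measurable_const : Measurable fun _ : Unit × Mark E => (0 : ℝ)) using 1
  funext w
  rcases w with w | w <;> rfl

lemma measurable_sum_stepGain (hh : Measurable h) (hg : Measurable g) (hv : Measurable v) (n : ℕ) :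
    Measurable fun ω : ℕ → Mark E => ∑ k ∈ Finset.range n, stepGain T h g (ω k) (ω (k + 1)) +
      markValue T v (ω n) :=
  (Finset.measurable_sum _ fun k _ => (measurable_stepGain hh hg).comp
    ((measurable_pi_apply k).prodMk (measurable_pi_apply (k + 1)))).add
    ((measurable_markValue hv).comp (measurable_pi_apply n))

lemma measurableSet_isStep : MeasurableSet {q : Mark E × Mark E | IsStep T q.1 q.2} := by
  have h1 : Measurable fun q : Mark E × Mark E => truncTime T q.1 :=
    measurable_truncTime.comp measurable_fst
  have h2 : Measurable fun q : Mark E × Mark E => truncTime T q.2 :=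
    measurable_truncTime.comp measurable_snd
  exact (measurableSet_lt h1 h2).union
    ((measurableSet_eq_fun h1 measurable_const).inter (measurableSet_eq_fun h2 measurable_const))

variable (ν : Kernel (ℝ × E) E) [IsFiniteKernel ν]

lemma ae_finiteJump_lt (p : ℝ × E) : ∀ᵐ z ∂(finiteJump ν p), p.1 < z.1 := by
  have hs : MeasurableSet {z : ℝ × E | z.1 ≤ p.1} :=
    measurableSet_le measurable_fst measurable_const
  have : finiteJump ν p {z | z.1 ≤ p.1} = 0 := by
    rw [← lintegral_indicator_one hs, lintegral_finiteJump ν p (measurable_one.indicator hs)]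
    refine (setLIntegral_congr_fun measurableSet_Ioi fun r hr => ?_).trans lintegral_zero
    simp [indicator, not_le.2 (show p.1 < r from hr)]
  rw [ae_iff]
  simpa using this

lemma ae_jumpKernel_isStep (m : Mark E) : ∀ᵐ m' ∂(jumpKernel ν m), IsStep T m m' := by
  have hms : MeasurableSet {m' : Mark E | IsStep T m m'} :=
    measurable_prodMk_left measurableSet_isStep
  have hdirac : ∀ m : Mark E, IsStep T m (Sum.inr ()) := fun m => by
    rcases (truncTime_le (T := T) m).lt_or_eq with hlt | heq
    · exact Or.inl hlt
    · exact Or.inr ⟨heq, rfl⟩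
  rcases m with p | u
  · change ∀ᵐ m' ∂((finiteJump ν p).map Sum.inl +
      (1 - finiteJump ν p univ) • Measure.dirac (Sum.inr ()) : Measure (Mark E)), _
    refine ae_add_measure_iff.2 ⟨(ae_map_iff measurable_inl.aemeasurable hms).2 ?_,
      Measure.ae_smul_measure ((ae_dirac_iff hms).2 (hdirac _)) _⟩
    filter_upwards [ae_finiteJump_lt ν p] with z hz
    simp only [IsStep, truncTime, Sum.elim_inl]
    rcases lt_or_ge p.1 T with hp | hp
    · exact Or.inl (by rw [min_eq_right hp.le]; exact lt_min hp hz)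
    · exact Or.inr ⟨min_eq_left hp, min_eq_left (hp.trans hz.le)⟩
  · change ∀ᵐ m' ∂(Measure.dirac (Sum.inr ()) : Measure (Mark E)), _
    exact (ae_dirac_iff hms).2 (hdirac _)

/-- Bounded supersolutions of the linear Kolmogorov equation with rate measure `ν`. -/
structure IsSupersolution (T : ℝ) (h : ℝ × E → ℝ) (g : E → ℝ) (v : ℝ × E → ℝ) (C : ℝ) :
    Prop where
  measurable_h : Measurable h
  measurable_g : Measurable g
  measurable_v : Measurable v
  bound_h : ∀ z, |h z| ≤ C
  bound_g : ∀ x, |g x| ≤ C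
  bound_v : ∀ z, |v z| ≤ C
  terminal : ∀ x, v (T, x) = g x
  absolutelyContinuous : ∀ x, AbsolutelyContinuousOnInterval (fun t => v (t, x)) 0 T
  deriv_le : ∀ x, ∀ᵐ r, r ∈ Icc 0 T → ∃ d, HasDerivAt (fun t => v (t, x)) d r ∧
    d ≤ -(∫ y, v (r, y) ∂(ν (r, x)) - jumpRate ν x r * v (r, x)) - h (r, x)

variable {ν}

/-- From `(s, e)` with `s < T`, a jump at `r < T` yields the gain up to `r` plus `v` at the new
mark; otherwise the result is the constant `a`, the gain of staying in `e` until `T`. Averaging with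
`integral_jumpKernel_before` produces the left side of `integral_survivalReal_le` for `u = v (·,
e)`. -/
lemma IsSupersolution.integral_step_le (hv : IsSupersolution ν T h g v C) (m : Mark E)
    (hm : 0 ≤ truncTime T m) :
    ∫ m', (stepGain T h g m m' + markValue T v m') ∂(jumpKernel ν m) ≤ markValue T v m := by
  rcases (truncTime_le (T := T) m).lt_or_eq with hlt | heq
  swap
  · rw [markValue_eq_zero heq]
    -- Past the horizon the next mark is almost surely past it too, and both terms vanish.
    refine (integral_eq_zero_of_ae ?_).le
    filter_upwards [ae_jumpKernel_isStep (T := T) ν m] with m' hm'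
    have hm'T : truncTime T m' = T := le_antisymm (truncTime_le _) (heq.symm.le.trans hm'.le)
    rw [stepGain_eq_zero heq, markValue_eq_zero hm'T, add_zero, Pi.zero_apply]
  rcases m with ⟨s, e⟩ | u
  swap
  · simp [truncTime] at hlt
  have hsT : s < T := by simpa [truncTime] using hlt
  have hs0 : 0 ≤ s := by simpa [truncTime, hsT.le] using hm
  have hC : 0 ≤ C := (abs_nonneg _).trans (hv.bound_h (s, e))
  have hhm : Measurable fun u => h (u, e) := hv.measurable_h.comp measurable_prodMk_right
  set a : ℝ := (∫ u in s..T, h (u, e)) + g e with ha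
  let B : ℝ × E → ℝ := fun z => (∫ u in s..max s (min T z.1), h (u, e)) + v z
  have hBm : Measurable B :=
    (measurable_intervalIntegral (F := fun z : (ℝ × E) × ℝ => h (z.2, e))
      (hhm.comp measurable_snd) measurable_const (by fun_prop)).add hv.measurable_v
  have hBC : ∀ z, |B z| ≤ C * T + C := fun z => by
    refine (abs_add_le _ _).trans (add_le_add ?_ (hv.bound_v z))
    have hi := intervalIntegral.norm_integral_le_of_norm_le_const (a := s)
      (b := max s (min T z.1)) (f := fun u => h (u, e)) (C := C) fun u _ => hv.bound_h _
    refine hi.trans (mul_le_mul_of_nonneg_left ?_ hC)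
    rw [abs_of_nonneg (sub_nonneg.2 (le_max_left _ _))]
    have := max_le hsT.le (min_le_left T z.1)
    linarith
  have hfun : ∀ m' : Mark E, stepGain T h g (Sum.inl (s, e)) m' + markValue T v m' =
      Sum.elim (fun z : ℝ × E => if z.1 < T then B z else a) (fun _ => a) m' := by
    rintro (z | u)
    · by_cases hz : z.1 < T
      · simp [stepGain, markValue, truncTime, hs0, hsT, hz, hz.not_ge, B]
      · simp [stepGain, markValue, truncTime, hs0, hsT, hz, not_lt.1 hz, ha, hsT.le]
    · simp [stepGain, markValue, truncTime, hs0, hsT, ha, hsT.le]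
  simp only [hfun]
  rw [integral_jumpKernel_before ν hsT.le e hBm hBC a]
  have hmv : markValue T v (Sum.inl (s, e)) = v (s, e) := by simp [markValue, hsT]
  rw [hmv]
  have hsub : Icc s T ⊆ Icc 0 T := Icc_subset_Icc_left hs0
  have hwC : ∀ r, |∫ y, v (r, y) ∂(ν (r, e))| ≤ C * ν.bound.toReal := fun r => by
    have := norm_integral_le_of_norm_le_const (μ := ν (r, e)) (f := fun y => v (r, y))
      (ae_of_all _ fun y => (Real.norm_eq_abs _).trans_le (hv.bound_v (r, y)))
    exact this.trans (mul_le_mul_of_nonneg_left (jumpRate_le ν e r) hC)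
  have hmain := integral_survivalReal_le (measurable_jumpRate ν e) (jumpRate_nonneg ν e)
    (jumpRate_le ν e) hsT.le hhm (measurable_integral_kernel ν e hv.measurable_v)
    (C := max C (C * ν.bound.toReal)) (fun r => (hv.bound_h _).trans (le_max_left _ _))
    (fun r => (hwC r).trans (le_max_right _ _))
    ((hv.absolutelyContinuous e).mono (by
      rwa [uIcc_of_le hsT.le, uIcc_of_le (hs0.trans hsT.le)]))
    (by filter_upwards [hv.deriv_le e] with r hr hrs using hr (hsub hrs))
    (a := a) (by rw [ha, hv.terminal])
  refine le_trans (le_of_eq ?_) hmain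
  congr 1
  refine intervalIntegral.integral_congr fun r hr => ?_
  rw [uIcc_of_le hsT.le] at hr
  have hvi : Integrable (fun y => v (r, y)) (ν (r, e)) :=
    Integrable.of_bound (hv.measurable_v.comp measurable_prodMk_left).aestronglyMeasurable C
      (ae_of_all _ fun y => hv.bound_v _)
  simp only [B, min_eq_right hr.2, max_eq_right hr.1]
  rw [integral_add (integrable_const _) hvi, integral_const, smul_eq_mul, jumpRate]
  ring

end Chain

/-! ### The law of the jump chain and the supermartingale argument -/

section ChainLaw

variable {E : Type*} [MeasurableSpace E] (ν : Kernel (ℝ × E) E) [IsFiniteKernel ν] (t : ℝ)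
  (μ : Measure E) [IsProbabilityMeasure μ]

instance : IsProbabilityMeasure (μ.map fun e => (Sum.inl (t, e) : Mark E)) :=
  Measure.isProbabilityMeasure_map
    (measurable_inl.comp (by fun_prop : Measurable fun e : E => (t, e))).aemeasurable

instance : IsProbabilityMeasure (jumpLaw ν t μ) := by
  unfold jumpLaw; infer_instance

lemma map_zero_jumpLaw :
    (jumpLaw ν t μ).map (fun ω => ω 0) = μ.map fun e => (Sum.inl (t, e) : Mark E) := by
  have h0 : (fun ω : ℕ → Mark E => ω 0) =
      (MeasurableEquiv.piUnique fun _ : Finset.Iic (0 : ℕ) => Mark E) ∘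
        Preorder.frestrictLe (π := fun _ => Mark E) 0 := by
    funext ω
    rfl
  rw [h0, ← Measure.map_map (MeasurableEquiv.measurable _) (by fun_prop), jumpLaw,
    Kernel.trajMeasure, Measure.map_comp _ _ (by fun_prop),
    Kernel.traj_map_frestrictLe_of_le le_rfl, Measure.deterministic_comp_eq_map]
  have h1 : Preorder.frestrictLe₂ (π := fun _ : ℕ => Mark E) (le_refl 0) = id := by
    funext ω
    rfl
  rw [h1, Measure.map_id, MeasurableEquiv.map_map_symm]

/-- The trajectory measure disintegrates over the whole history, but the kernel reads only its last
coordinate, so the identity descends to two consecutive marks. -/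
lemma map_succ_jumpLaw (n : ℕ) :
    (jumpLaw ν t μ).map (fun ω => (ω n, ω (n + 1))) =
      (jumpLaw ν t μ).map (fun ω => ω n) ⊗ₘ jumpKernel ν := by
  refine Measure.ext_of_lintegral _ fun F hF => ?_
  have hK := Kernel.map_frestrictLe_trajMeasure_compProd_eq_map_trajMeasure
    (X := fun _ => Mark E) (μ₀ := μ.map fun e => Sum.inl (t, e)) (κ := fun n =>
      (jumpKernel ν).comap (fun h : Π i : Finset.Iic n, Mark E => h ⟨n, Finset.mem_Iic.2 le_rfl⟩)
        (by fun_prop)) (a := n)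
  have hF' : Measurable fun q : (Π i : Finset.Iic n, Mark E) × Mark E =>
      F (q.1 ⟨n, Finset.mem_Iic.2 le_rfl⟩, q.2) := hF.comp (by fun_prop)
  have h2 := congrArg (fun m => ∫⁻ q, F (q.1 ⟨n, Finset.mem_Iic.2 le_rfl⟩, q.2) ∂m) hK
  rw [lintegral_map hF' (by fun_prop), Measure.lintegral_compProd hF', lintegral_map
    (Measurable.lintegral_kernel_prod_right' hF') (by fun_prop)] at h2
  rw [lintegral_map hF (by fun_prop), Measure.lintegral_compProd hF, lintegral_map
    hF.lintegral_kernel_prod_right' (by fun_prop)]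
  exact h2.symm

lemma integral_succ_jumpLaw {Ψ : Mark E × Mark E → ℝ} (hΨ : Measurable Ψ) {C : ℝ}
    (hC : ∀ q, |Ψ q| ≤ C) (n : ℕ) :
    ∫ ω, Ψ (ω n, ω (n + 1)) ∂(jumpLaw ν t μ) =
      ∫ ω, ∫ m', Ψ (ω n, m') ∂(jumpKernel ν (ω n)) ∂(jumpLaw ν t μ) := by
  have : IsProbabilityMeasure ((jumpLaw ν t μ).map fun ω => ω n) :=
    Measure.isProbabilityMeasure_map (measurable_pi_apply n).aemeasurable
  rw [← integral_map (φ := fun ω : ℕ → Mark E => (ω n, ω (n + 1))) (f := Ψ) (by fun_prop)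
    hΨ.aestronglyMeasurable, map_succ_jumpLaw, Measure.integral_compProd
    (Integrable.of_bound hΨ.aestronglyMeasurable C (ae_of_all _ hC)),
    integral_map (measurable_pi_apply n).aemeasurable
    (hΨ.stronglyMeasurable.integral_kernel_prod_right' (κ := jumpKernel ν)).aestronglyMeasurable]

lemma ae_isStep (T : ℝ) : ∀ᵐ ω ∂(jumpLaw ν t μ), ∀ n, IsStep T (ω n) (ω (n + 1)) := by
  refine ae_all_iff.2 fun n => ?_
  have h : ∀ᵐ q ∂((jumpLaw ν t μ).map fun ω => (ω n, ω (n + 1))), IsStep T q.1 q.2 := by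
    have : IsProbabilityMeasure ((jumpLaw ν t μ).map fun ω => ω n) :=
      Measure.isProbabilityMeasure_map (measurable_pi_apply n).aemeasurable
    rw [map_succ_jumpLaw]
    exact Measure.ae_compProd_of_ae_ae measurableSet_isStep
      (ae_of_all _ fun m => ae_jumpKernel_isStep ν m)
  exact ae_of_ae_map (by fun_prop) h

lemma ae_zero_jumpLaw_dirac [MeasurableSingletonClass E] (x : E) :
    ∀ᵐ ω ∂(jumpLaw ν t (Measure.dirac x)), ω 0 = Sum.inl (t, x) := by
  have hs : MeasurableSet {m : Mark E | m = Sum.inl (t, x)} := by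
    have : MeasurableSet ((Sum.inl : ℝ × E → Mark E) '' {(t, x)}) :=
      (measurableSet_singleton _).inl_image
    rwa [image_singleton] at this
  have h : ∀ᵐ m ∂((jumpLaw ν t (Measure.dirac x)).map fun ω => ω 0), m = Sum.inl (t, x) := by
    rw [map_zero_jumpLaw, Measure.map_dirac' (f := fun e : E => (Sum.inl (t, e) : Mark E))
      (measurable_inl.comp (by fun_prop : Measurable fun e : E => (t, e)))]
    exact (ae_dirac_iff hs).2 rfl
  exact ae_of_ae_map (measurable_pi_apply 0).aemeasurable h

variable {ν t} [MeasurableSingletonClass E] {T : ℝ}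

/-- `markValue T (fun _ => 1)` is the indicator of `T_n < T`. By the Markov property each further
jump before `T` costs a factor at most `1 - exp (-(ν.bound.toReal * T))`. -/
lemma integral_markValue_one_le (ht : t ∈ Icc 0 T) (x : E) (n : ℕ) :
    ∫ ω, markValue T (fun _ => 1) (ω n) ∂(jumpLaw ν t (Measure.dirac x)) ≤
      (1 - Real.exp (-(ν.bound.toReal * T))) ^ n := by
  set P := jumpLaw ν t (Measure.dirac x) with hP
  have hb1 : ∀ m : Mark E, |markValue T (fun _ => 1) m| ≤ 1 :=
    abs_markValue_le (by simp) zero_le_one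
  have hb0 : ∀ m : Mark E, 0 ≤ markValue T (fun _ => 1) m := by
    rintro (p | u)
    · simp only [markValue, Sum.elim_inl]; split_ifs <;> norm_num
    · exact le_rfl
  have hbm : Measurable (markValue T (fun _ => 1) : Mark E → ℝ) :=
    measurable_markValue measurable_const
  have hbi : ∀ n, Integrable (fun ω : ℕ → Mark E => markValue T (fun _ => 1) (ω n)) P := fun n =>
    Integrable.of_bound (hbm.comp (measurable_pi_apply n)).aestronglyMeasurable 1
      (ae_of_all _ fun ω => hb1 _)
  have hθ : 0 ≤ 1 - Real.exp (-(ν.bound.toReal * T)) := by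
    refine sub_nonneg.2 (Real.exp_le_one_iff.2 (neg_nonpos.2 ?_))
    exact mul_nonneg ENNReal.toReal_nonneg (ht.1.trans ht.2)
  induction n with
  | zero =>
    refine (integral_mono (hbi 0) (integrable_const 1) fun ω => (le_abs_self _).trans (hb1 _)).trans
      ?_
    simp
  | succ n ih =>
    -- The one-step bound needs the current time in `[0, T]`. Almost surely the `n`-th mark lies in
    -- `D` whenever the next one is before `T`, so inserting the indicator of `D` leaves the
    -- integral unchanged.
    let D : Set (Mark E) := {m | 0 ≤ truncTime T m ∧ truncTime T m < T}
    have hD : MeasurableSet D := (measurableSet_le measurable_const measurable_truncTime).inter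
      (measurableSet_lt measurable_truncTime measurable_const)
    classical
    let Ψ : Mark E × Mark E → ℝ := fun q => if q.1 ∈ D then markValue T (fun _ => 1) q.2 else 0
    have hΨ : Measurable Ψ :=
      Measurable.ite (measurable_fst hD) (hbm.comp measurable_snd) measurable_const
    have hΨ1 : ∀ q, |Ψ q| ≤ 1 := fun q => by
      simp only [Ψ]
      split_ifs
      exacts [hb1 _, by simp]
    have heq : ∫ ω, markValue T (fun _ => 1) (ω (n + 1)) ∂P = ∫ ω, Ψ (ω n, ω (n + 1)) ∂P := by
      refine integral_congr_ae ?_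
      filter_upwards [ae_isStep ν t (Measure.dirac x) T, ae_zero_jumpLaw_dirac ν t x] with ω hω h0
      have hmono : Monotone fun n => truncTime T (ω n) :=
        monotone_nat_of_le_succ fun n => (hω n).le
      have hτ0 : truncTime T (ω 0) = t := by simp [h0, truncTime, ht.2]
      simp only [Ψ]
      split_ifs with hmem
      · rfl
      · refine markValue_eq_zero ?_
        by_contra hne
        refine hmem ⟨ht.1.trans (hτ0.symm.le.trans (hmono (Nat.zero_le n))), ?_⟩
        exact (hmono (Nat.le_succ n)).trans_lt ((truncTime_le _).lt_of_ne hne)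
    rw [heq, integral_succ_jumpLaw ν t _ hΨ hΨ1 n, pow_succ']
    refine le_trans (integral_mono ?_ ((hbi n).const_mul (1 - Real.exp (-(ν.bound.toReal * T))))
      fun ω => ?_) ((integral_const_mul _ _).trans_le (mul_le_mul_of_nonneg_left ih hθ))
    · refine Integrable.of_bound ((hΨ.stronglyMeasurable.integral_kernel_prod_right'
        (κ := jumpKernel ν)).measurable.comp (measurable_pi_apply n)).aestronglyMeasurable 1
        (ae_of_all _ fun ω => ?_)
      have := norm_integral_le_of_norm_le_const (μ := jumpKernel ν (ω n))
        (f := fun m' => Ψ (ω n, m')) (C := 1) (ae_of_all _ fun m' => hΨ1 _)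
      simpa using this
    · simp only [Ψ]
      split_ifs with hmem
      · rcases hm : ω n with p | u
        · rw [hm] at hmem
          have hp : p.1 < T := by simpa [D, truncTime] using hmem.2
          have hp0 : 0 ≤ p.1 := by simpa [truncTime, hp.le] using hmem.1
          have := integral_jumpKernel_lt_le ν hp0 hp.le p.2
          rw [show markValue T (fun _ => 1) (Sum.inl p : Mark E) = 1 by simp [markValue, hp],
            mul_one]
          exact this
        · rw [hm] at hmem
          exact absurd hmem.2 (lt_irrefl _)
      · simpa using mul_nonneg hθ (hb0 _)

/-- The jump times almost surely exceed `T`. -/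
lemma ae_exists_truncTime_eq (ht : t ∈ Icc 0 T) (x : E) :
    ∀ᵐ ω ∂(jumpLaw ν t (Measure.dirac x)), ∃ n, truncTime T (ω n) = T := by
  set P := jumpLaw ν t (Measure.dirac x) with hP
  let A : Set (ℕ → Mark E) := ⋂ n, {ω | truncTime T (ω n) < T}
  have hA : MeasurableSet A := MeasurableSet.iInter fun n =>
    measurableSet_lt (measurable_truncTime.comp (measurable_pi_apply n)) measurable_const
  have hle : ∀ n, P.real A ≤ (1 - Real.exp (-(ν.bound.toReal * T))) ^ n := fun n => by
    refine le_trans ?_ (integral_markValue_one_le ht x n)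
    rw [← integral_indicator_one hA]
    refine integral_mono ((integrable_const 1).indicator hA) ?_ fun ω => ?_
    · exact Integrable.of_bound ((measurable_markValue measurable_const).comp
        (measurable_pi_apply n)).aestronglyMeasurable 1
        (ae_of_all _ fun ω => abs_markValue_le (by simp) zero_le_one _)
    · by_cases hω : ω ∈ A
      · have hn : truncTime T (ω n) < T := mem_iInter.1 hω n
        rw [indicator_of_mem hω]
        rcases hm : ω n with p | u
        · have hp : p.1 < T := by simpa [hm, truncTime] using hn
          simp [markValue, hp]
        · simp [hm, truncTime] at hn
      · rw [indicator_of_notMem hω]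
        rcases ω n with p | u
        · simp only [markValue, Sum.elim_inl]; split_ifs <;> norm_num
        · exact le_rfl
  have hθ0 : 0 ≤ 1 - Real.exp (-(ν.bound.toReal * T)) := by
    refine sub_nonneg.2 (Real.exp_le_one_iff.2 (neg_nonpos.2 ?_))
    exact mul_nonneg ENNReal.toReal_nonneg (ht.1.trans ht.2)
  have h0 : P.real A = 0 := le_antisymm (ge_of_tendsto'
    (tendsto_pow_atTop_nhds_zero_of_lt_one hθ0 (sub_lt_self _ (Real.exp_pos _))) hle)
    measureReal_nonneg
  rw [measureReal_eq_zero_iff] at h0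
  filter_upwards [measure_eq_zero_iff_ae_notMem.1 h0] with ω hω
  by_contra! hne
  exact hω (mem_iInter.2 fun n => (truncTime_le _).lt_of_ne (hne n))

variable {h v : ℝ × E → ℝ} {g : E → ℝ} {C : ℝ}

/-- The gain `∫_t^T h(s, X_s) ds + g(X_T)` along a path. -/
def pathGain (T : ℝ) (h : ℝ × E → ℝ) (g : E → ℝ) (t : ℝ) (ω : ℕ → Mark E) : ℝ :=
  (∫ s in t..T, (X s ω).elim 0 fun y => h (s, y)) + (X T ω).elim 0 g

/-- Almost every path passes `T` after finitely many jumps, and from then on the sequence is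
constant. The function `v` is arbitrary, since its term has then vanished. -/
lemma ae_tendsto_sum_stepGain (hhm : Measurable h) (hh : ∀ z, |h z| ≤ C) (ht : t ∈ Ico 0 T)
    (x : E) (v : ℝ × E → ℝ) : ∀ᵐ ω ∂(jumpLaw ν t (Measure.dirac x)),
    Tendsto (fun n => ∑ k ∈ Finset.range n, stepGain T h g (ω k) (ω (k + 1)) +
      markValue T v (ω n)) atTop (𝓝 (pathGain T h g t ω)) := by
  filter_upwards [ae_isStep ν t (Measure.dirac x) T, ae_zero_jumpLaw_dirac ν t x,
    ae_exists_truncTime_eq ⟨ht.1, ht.2.le⟩ x] with ω hω h0 ⟨N, hN⟩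
  have hmono : Monotone fun n => truncTime T (ω n) := monotone_nat_of_le_succ fun n => (hω n).le
  refine tendsto_const_nhds.congr' ?_
  filter_upwards [eventually_ge_atTop N] with n hn
  have hτ : truncTime T (ω n) = T := le_antisymm (truncTime_le _) (hN.symm.le.trans (hmono hn))
  rw [(sum_stepGain hhm hh ht.1 ht.2 h0 hω n).2, markValue_eq_zero hτ, hτ, if_pos le_rfl, add_zero]
  rfl

/-- Bounding the summands separately would give a bound growing with `n`. Regrouped by
`sum_stepGain` they form one integral over a part of `[0, T]` plus at most one terminal gain, hence
a bound fit for dominated convergence. -/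
lemma ae_abs_sum_stepGain_le (hhm : Measurable h) (hh : ∀ z, |h z| ≤ C) (hg : ∀ x, |g x| ≤ C)
    (hv : ∀ z, |v z| ≤ C) (ht : t ∈ Ico 0 T) (x : E) :
    ∀ᵐ ω ∂(jumpLaw ν t (Measure.dirac x)), ∀ n,
      |∑ k ∈ Finset.range n, stepGain T h g (ω k) (ω (k + 1)) + markValue T v (ω n)| ≤
        C * T + C + C := by
  filter_upwards [ae_isStep ν t (Measure.dirac x) T, ae_zero_jumpLaw_dirac ν t x] with ω hω h0 n
  have hC : 0 ≤ C := (abs_nonneg _).trans (hg x)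
  have hmono : Monotone fun n => truncTime T (ω n) := monotone_nat_of_le_succ fun n => (hω n).le
  have hτ0 : truncTime T (ω 0) = t := by simp [h0, truncTime, ht.2.le]
  rw [(sum_stepGain hhm hh ht.1 ht.2 h0 hω n).2]
  have h1 := intervalIntegral.norm_integral_le_of_norm_le_const (a := t)
    (b := truncTime T (ω n)) (f := fun s => (X s ω).elim 0 fun y => h (s, y)) (C := C) fun s _ => by
      rcases X s ω with _ | y
      exacts [by simpa using hC, hh _]
  rw [abs_of_nonneg (sub_nonneg.2 (hτ0.symm.le.trans (hmono (Nat.zero_le n))))] at h1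
  have h2 : C * (truncTime T (ω n) - t) ≤ C * T := mul_le_mul_of_nonneg_left
    (by linarith [ht.1, truncTime_le (T := T) (ω n)]) hC
  have h3 : |if T ≤ truncTime T (ω n) then (X T ω).elim 0 g else 0| ≤ C := by
    split_ifs
    · rcases X T ω with _ | y
      exacts [by simpa using hC, hg _]
    · simpa using hC
  refine (abs_add_le _ _).trans (add_le_add ((abs_add_le _ _).trans (add_le_add (h1.trans h2) h3))
    (abs_markValue_le hv hC _))

lemma ae_pathGain_self (x : E) :
    ∀ᵐ ω ∂(jumpLaw ν T (Measure.dirac x)), pathGain T h g T ω = g x := by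
  filter_upwards [ae_isStep ν T (Measure.dirac x) T, ae_zero_jumpLaw_dirac ν T x] with ω hω h0
  have hτ0 : truncTime T (ω 0) = T := by simp [h0, truncTime]
  rw [pathGain, X_eq_pos hω (Or.inl rfl) (hτ0.symm.le.trans (hω 0).le), h0]
  simp [Mark.pos]

/-- As an almost sure limit of measurable finite sums, the gain is measurable without any joint
measurability of `(s, ω) ↦ X s ω`. -/
lemma aestronglyMeasurable_pathGain (hhm : Measurable h) (hh : ∀ z, |h z| ≤ C)
    (hg : Measurable g) (ht : t ∈ Icc 0 T) (x : E) :
    AEStronglyMeasurable (pathGain T h g t) (jumpLaw ν t (Measure.dirac x)) := by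
  rcases ht.2.lt_or_eq with hlt | rfl
  · exact aestronglyMeasurable_of_tendsto_ae atTop
      (fun n => (measurable_sum_stepGain hhm hg (measurable_const (a := (0 : ℝ))) n
        (T := T)).aestronglyMeasurable)
      (ae_tendsto_sum_stepGain hhm hh ⟨ht.1, hlt⟩ x fun _ => 0)
  · exact aestronglyMeasurable_const.congr (EventuallyEq.symm (ae_pathGain_self x))

/-- A bounded supersolution dominates the expected gain. -/
theorem IsSupersolution.integral_pathGain_le (hv : IsSupersolution ν T h g v C) (ht : t ∈ Icc 0 T)
    (x : E) : ∫ ω, pathGain T h g t ω ∂(jumpLaw ν t (Measure.dirac x)) ≤ v (t, x) := by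
  rcases ht.2.lt_or_eq with hlt | rfl
  swap
  · rw [integral_congr_ae (ae_pathGain_self x), hv.terminal]
    simp
  have hC : 0 ≤ C := (abs_nonneg _).trans (hv.bound_g x)
  have hT : 0 ≤ T := ht.1.trans ht.2
  have ht' : t ∈ Ico 0 T := ⟨ht.1, hlt⟩
  set P := jumpLaw ν t (Measure.dirac x) with hP
  let M : ℕ → (ℕ → Mark E) → ℝ := fun n ω =>
    ∑ k ∈ Finset.range n, stepGain T h g (ω k) (ω (k + 1)) + markValue T v (ω n)
  have hMm : ∀ n, AEStronglyMeasurable (M n) P := fun n =>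
    (measurable_sum_stepGain hv.measurable_h hv.measurable_g hv.measurable_v n).aestronglyMeasurable
  have hMb := ae_abs_sum_stepGain_le (ν := ν) hv.measurable_h hv.bound_h hv.bound_g hv.bound_v ht' x
  have hMi : ∀ n, Integrable (M n) P := fun n => Integrable.of_bound (hMm n) (C * T + C + C)
    (by filter_upwards [hMb] with ω hω using hω n)
  have hmvm := measurable_markValue (T := T) hv.measurable_v
  let Ψ : Mark E × Mark E → ℝ := fun q => stepGain T h g q.1 q.2 + markValue T v q.2
  have hΨ : Measurable Ψ :=
    (measurable_stepGain hv.measurable_h hv.measurable_g).add (hmvm.comp measurable_snd)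
  have hΨC : ∀ q, |Ψ q| ≤ C * T + C + C := fun q => (abs_add_le _ _).trans
    (add_le_add (abs_stepGain_le hv.bound_h hv.bound_g hT hC _ _) (abs_markValue_le hv.bound_v hC _))
  have hmvi : ∀ n, Integrable (fun ω : ℕ → Mark E => markValue T v (ω n)) P := fun n =>
    Integrable.of_bound (hmvm.comp (measurable_pi_apply n)).aestronglyMeasurable C
      (ae_of_all _ fun ω => abs_markValue_le hv.bound_v hC _)
  have hΨi : ∀ n, Integrable (fun ω : ℕ → Mark E => Ψ (ω n, ω (n + 1))) P := fun n =>
    Integrable.of_bound (hΨ.comp ((measurable_pi_apply n).prodMk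
      (measurable_pi_apply (n + 1)))).aestronglyMeasurable _ (ae_of_all _ fun ω => hΨC _)
  -- Only expectations are compared; no filtration or conditional expectation is needed.
  have hstep : ∀ n, ∫ ω, Ψ (ω n, ω (n + 1)) ∂P ≤ ∫ ω, markValue T v (ω n) ∂P := fun n => by
    rw [integral_succ_jumpLaw ν t _ hΨ hΨC n]
    refine integral_mono_ae ?_ (hmvi n) ?_
    · refine Integrable.of_bound ((hΨ.stronglyMeasurable.integral_kernel_prod_right'
        (κ := jumpKernel ν)).measurable.comp (measurable_pi_apply n)).aestronglyMeasurable
        (C * T + C + C) (ae_of_all _ fun ω => ?_)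
      have := norm_integral_le_of_norm_le_const (μ := jumpKernel ν (ω n))
        (f := fun m' => Ψ (ω n, m')) (ae_of_all _ fun m' => hΨC _)
      simpa using this
    · filter_upwards [ae_isStep ν t (Measure.dirac x) T, ae_zero_jumpLaw_dirac ν t x] with ω hω h0
      have hmono : Monotone fun n => truncTime T (ω n) :=
        monotone_nat_of_le_succ fun n => (hω n).le
      have hτ0 : truncTime T (ω 0) = t := by simp [h0, truncTime, ht.2]
      exact hv.integral_step_le (ω n) (ht.1.trans (hτ0.symm.le.trans (hmono (Nat.zero_le n))))
  have hM : ∀ n, ∫ ω, M n ω ∂P ≤ v (t, x) := fun n => by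
    induction n with
    | zero =>
      have : ∀ᵐ ω ∂P, M 0 ω = v (t, x) := by
        filter_upwards [ae_zero_jumpLaw_dirac ν t x] with ω h0
        simp [M, h0, markValue, hlt]
      rw [integral_congr_ae this]
      simp
    | succ n ih =>
      have hsucc : ∀ ω, M (n + 1) ω = M n ω + Ψ (ω n, ω (n + 1)) - markValue T v (ω n) := fun ω => by
        simp only [M, Ψ, Finset.sum_range_succ]
        ring
      simp only [hsucc]
      rw [integral_sub (f := fun ω => M n ω + Ψ (ω n, ω (n + 1))) ((hMi n).add (hΨi n)) (hmvi n),
        integral_add (hMi n) (hΨi n)]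
      linarith [hstep n]
  refine le_of_tendsto' (tendsto_integral_of_dominated_convergence (fun _ => C * T + C + C) hMm
    (integrable_const _) (fun n => ?_)
    (ae_tendsto_sum_stepGain hv.measurable_h hv.bound_h ht' x v)) hM
  filter_upwards [hMb] with ω hω using hω n

end ChainLaw

lemma real_univ_le_bound {Y Z : Type*} [MeasurableSpace Y] [MeasurableSpace Z] (κ : Kernel Y Z)
    [IsFiniteKernel κ] (p : Y) : (κ p).real univ ≤ κ.bound.toReal :=
  ENNReal.toReal_mono κ.bound_ne_top (κ.measure_le_bound _ _)

/-- With `i` built from `clamp T`, this turns data given on `[0, T]` into bounded lower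
semicontinuous functions of all times. -/
lemma IsLSCb.comp {Y Z : Type*} [TopologicalSpace Y] [TopologicalSpace Z] {φ : Z → ℝ} {S : Set Z}
    (hφ : IsLSCb φ S) {i : Y → Z} (hi : Continuous i) (hS : ∀ y, i y ∈ S) :
    BddLSC fun y => φ (i y) := by
  refine ⟨fun y c hc => ?_, hφ.2.imp fun C hC y => hC _ (hS y)⟩
  exact (tendsto_nhdsWithin_iff.2 ⟨hi.continuousAt, Eventually.of_forall hS⟩).eventually
    (hφ.1 (i y) (hS y) c hc)

lemma pathGain_neg {E : Type*} [MeasurableSpace E] {T : ℝ} {g : E → ℝ} (h : ℝ × E → ℝ) (t : ℝ) (ω : ℕ → Mark E) :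
    pathGain T (fun z => -h z) (fun x => -g x) t ω = -pathGain T h g t ω := by
  rw [pathGain, pathGain, neg_add, ← intervalIntegral.integral_neg]
  congr 1
  · refine intervalIntegral.integral_congr fun s _ => ?_
    rcases X s ω with _ | y <;> simp
  · rcases X T ω with _ | y <;> simp

/-! ### Verification and the main theorem -/

section Verification

variable {E A : Type*} [MeasurableSpace E] [MeasurableSpace A] {T : ℝ} {f : ℝ → E → A → ℝ}
  {g : E → ℝ}

/-- The running gain collected under a feedback control, extended constantly outside `[0, T]`. -/
def controlledGain (T : ℝ) (f : ℝ → E → A → ℝ) (α : Admissible E A) (z : ℝ × E) : ℝ :=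
  f (clamp T z.1) z.2 (α.1 z)

lemma reward_eq_pathGain (α : Admissible E A) {t : ℝ} (ht : t ∈ Icc 0 T) :
    reward T f g α t = pathGain T (controlledGain T f α) g t := by
  funext ω
  rw [reward, pathGain]
  congr 1
  refine intervalIntegral.integral_congr fun s hs => ?_
  rw [uIcc_of_le ht.2] at hs
  simp only [controlledGain, clamp_of_mem ⟨ht.1.trans hs.1, hs.2⟩]

variable {κ : Kernel (E × A) E}

lemma IsHJBSolution.absolutelyContinuous_clamp {w : ℝ → E → ℝ}
    (hw : IsHJBSolution T κ f g w) (hT : 0 ≤ T) (x : E) :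
    AbsolutelyContinuousOnInterval (fun t => w (clamp T t) x) 0 T :=
  absolutelyContinuousOnInterval_congr (hw.absolutelyContinuous x) fun t ht => by
    rw [uIcc_of_le hT] at ht
    simp only [clamp_of_mem ht]

variable [IsFiniteKernel κ] [TopologicalSpace E] [BorelSpace E]

lemma controlled_generator_eq {v : ℝ × E → ℝ} (hv : BddLSC v) (α : Admissible E A) (r : ℝ)
    (x : E) :
    ∫ y, v (r, y) ∂(controlledRate κ α (r, x)) - jumpRate (controlledRate κ α) x r * v (r, x) =
      ∫ y, v (r, y) ∂(uniformized κ.bound.toReal κ (x, α.1 (r, x))) -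
        κ.bound.toReal * v (r, x) := by
  have hm : BddLSC fun y => v (r, y) := hv.comp (by fun_prop)
  obtain ⟨C, hC⟩ := hm.2
  rw [integral_uniformized (real_univ_le_bound κ) _ hm.measurable hC]
  change ∫ y, v (r, y) ∂(κ (x, α.1 (r, x))) - (κ (x, α.1 (r, x))).real univ * v (r, x) = _
  ring

variable [SecondCountableTopology E] [TopologicalSpace A]

lemma IsHJBSolution.ae_hasDerivAt_clamp [TopologicalSpace.MetrizableSpace E] [Nonempty A]
    {w : ℝ → E → ℝ} (hw : IsHJBSolution T κ f g w)
    (hκ : IsFeller κ) (hf : BddLSC fun z : (ℝ × E) × A => f (clamp T z.1.1) z.1.2 z.2)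
    (hwL : BddLSC fun z : ℝ × E => w (clamp T z.1) z.2) (x : E) :
    ∀ᵐ r, r ∈ Icc 0 T → HasDerivAt (fun t => w (clamp T t) x)
      (κ.bound.toReal * w (clamp T r) x - uniformizedHamiltonian κ.bound.toReal κ
        (fun z => f (clamp T z.1.1) z.1.2 z.2) (fun z => w (clamp T z.1) z.2) (r, x)) r := by
  filter_upwards [(ae_restrict_iff' measurableSet_Icc).1 (hw.equation x),
    (Ioo_ae_eq_Icc (a := (0 : ℝ)) (b := T) (μ := volume)).mem_iff] with r hr hmem hrI
  -- `clamp T` has corners at `0` and `T`; these two times form a null set and are left out.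
  have hrO := hmem.2 hrI
  have h1 : HasDerivAt (fun t => w (clamp T t) x) _ r := (hr hrI).congr_of_eventuallyEq (by
    filter_upwards [Icc_mem_nhds hrO.1 hrO.2] with s hs
    rw [clamp_of_mem hs])
  refine h1.congr_deriv ?_
  have h2 := hamiltonian_eq (f := f) hκ (real_univ_le_bound κ) hf hwL (t := r) (x := x)
    fun a => by rw [clamp_of_mem hrI]
  have h3 : hamiltonian κ f w r x = hamiltonian κ f (fun t x => w (clamp T t) x) r x := by
    simp only [hamiltonian, clamp_of_mem hrI]
  rw [h3, h2]
  ring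

variable [BorelSpace A] [SecondCountableTopology A]

lemma measurable_controlledGain (hf : BddLSC fun z : (ℝ × E) × A => f (clamp T z.1.1) z.1.2 z.2)
    (α : Admissible E A) : Measurable (controlledGain T f α) :=
  hf.measurable.comp (measurable_id.prodMk α.2)

variable [TopologicalSpace.MetrizableSpace E]

lemma integrable_reward (hf : BddLSC fun z : (ℝ × E) × A => f (clamp T z.1.1) z.1.2 z.2)
    (hg : BddLSC g) {t : ℝ} (ht : t ∈ Icc 0 T) (x : E) (α : Admissible E A) :
    Integrable (reward T f g α t) (controlledLaw κ α t x) := by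
  have : IsProbabilityMeasure (controlledLaw κ α t x) := by unfold controlledLaw; infer_instance
  obtain ⟨C, hC⟩ := hf.2
  obtain ⟨D, hD⟩ := hg.2
  have hC0 : 0 ≤ C := (abs_nonneg _).trans (hC ((t, x), α.1 (t, x)))
  rw [reward_eq_pathGain α ht]
  have hb : ∀ z, |controlledGain T f α z| ≤ C := fun z => hC (z, α.1 z)
  refine (Integrable.of_bound (aestronglyMeasurable_pathGain (measurable_controlledGain hf α)
    hb hg.measurable ht x) (C * |T - t| + D) (ae_of_all _ fun ω => ?_))
  refine (abs_add_le _ _).trans (add_le_add (intervalIntegral.norm_integral_le_of_norm_le_const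
    (f := fun s => (X s ω).elim 0 fun y => controlledGain T f α (s, y)) fun s _ => ?_) ?_)
  · rcases X s ω with _ | y
    exacts [by simpa using hC0, hb _]
  · rcases X T ω with _ | y
    exacts [by simpa using (abs_nonneg _).trans (hD x), hD _]

variable [Nonempty A] {w : ℝ → E → ℝ}

/-- The supremum in the Hamiltonian dominates the term of the action chosen by `α`. -/
lemma IsHJBSolution.isSupersolution (hw : IsHJBSolution T κ f g w) (hT : 0 ≤ T) (hκ : IsFeller κ)
    (hf : BddLSC fun z : (ℝ × E) × A => f (clamp T z.1.1) z.1.2 z.2) (hg : BddLSC g)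
    (hwL : BddLSC fun z : ℝ × E => w (clamp T z.1) z.2) (α : Admissible E A) :
    ∃ C, IsSupersolution (controlledRate κ α) T (controlledGain T f α) g
      (fun z => w (clamp T z.1) z.2) C := by
  obtain ⟨Cf, hCf⟩ := hf.2
  obtain ⟨Cg, hCg⟩ := hg.2
  obtain ⟨Cw, hCw⟩ := hwL.2
  refine ⟨max Cf (max Cg Cw), measurable_controlledGain hf α, hg.measurable, hwL.measurable,
    fun z => (hCf (z, α.1 z)).trans (le_max_left _ _),
    fun x => (hCg x).trans ((le_max_left _ _).trans (le_max_right _ _)),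
    fun z => (hCw z).trans ((le_max_right _ _).trans (le_max_right _ _)), fun x => ?_,
    hw.absolutelyContinuous_clamp hT, fun x => ?_⟩
  · simp only [clamp_of_mem ⟨hT, le_rfl⟩, hw.terminal]
  · filter_upwards [hw.ae_hasDerivAt_clamp hκ hf hwL x] with r hr hrI
    refine ⟨_, hr hrI, ?_⟩
    rw [controlled_generator_eq hwL]
    obtain ⟨-, B, hB⟩ := (hwL.integral_uniformized hκ (real_univ_le_bound κ)).add hf
    have hle : _ ≤ uniformizedHamiltonian κ.bound.toReal κ (fun z => f (clamp T z.1.1) z.1.2 z.2)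
        (fun z => w (clamp T z.1) z.2) (r, x) :=
      le_ciSup (f := fun a => ∫ y, w (clamp T r) y ∂(uniformized κ.bound.toReal κ (x, a)) +
        f (clamp T r) x a) ⟨B, by rintro _ ⟨a, rfl⟩; exact le_of_abs_le (hB ((r, x), a))⟩
        (α.1 (r, x))
    simp only [controlledGain]
    linarith

/-- Up to an arbitrarily small drift, the negative of a solution of the HJB equation is a
supersolution for a suitable control. -/
lemma IsHJBSolution.exists_isSupersolution_neg (hw : IsHJBSolution T κ f g w) (hT : 0 ≤ T)
    (hκ : IsFeller κ) (hf : BddLSC fun z : (ℝ × E) × A => f (clamp T z.1.1) z.1.2 z.2)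
    (hg : BddLSC g) (hwL : BddLSC fun z : ℝ × E => w (clamp T z.1) z.2) {ε : ℝ} (hε : 0 < ε) :
    ∃ (α : Admissible E A) (C : ℝ), IsSupersolution (controlledRate κ α) T
      (fun z => -controlledGain T f α z) (fun x => -g x)
      (fun z => -w (clamp T z.1) z.2 + ε * (T - clamp T z.1)) C := by
  obtain ⟨α, hα⟩ := exists_measurable_hamiltonian_lt hκ (real_univ_le_bound κ) hf hwL hε
  obtain ⟨Cf, hCf⟩ := hf.2
  obtain ⟨Cg, hCg⟩ := hg.2
  obtain ⟨Cw, hCw⟩ := hwL.2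
  refine ⟨α, max Cf (max Cg (Cw + ε * T)), (measurable_controlledGain hf α).neg,
    hg.measurable.neg, hwL.measurable.neg.add (measurable_const.mul (measurable_const.sub
      ((continuous_clamp T).measurable.comp measurable_fst))),
    fun z => (abs_neg _).trans_le ((hCf (z, α.1 z)).trans (le_max_left _ _)),
    fun x => (abs_neg _).trans_le ((hCg x).trans ((le_max_left _ _).trans (le_max_right _ _))),
    fun z => ?_, fun x => ?_, fun x => ?_, fun x => ?_⟩
  · refine (abs_add_le _ _).trans (le_trans (add_le_add ((abs_neg _).trans_le (hCw z)) ?_)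
      ((le_max_right _ _).trans (le_max_right _ _)))
    have h1 := clamp_le hT z.1
    have h2 := clamp_nonneg T z.1
    rw [abs_of_nonneg (mul_nonneg hε.le (by linarith))]
    gcongr
    linarith
  · simp only [clamp_of_mem ⟨hT, le_rfl⟩, hw.terminal, sub_self, mul_zero, add_zero]
  · have h1 : AbsolutelyContinuousOnInterval (fun t => ε * (T - t)) 0 T :=
      ContDiffOn.absolutelyContinuousOnInterval (by fun_prop)
    refine absolutelyContinuousOnInterval_congr
      ((hw.absolutelyContinuous_clamp hT x).neg.add h1) fun t ht => ?_
    rw [uIcc_of_le hT] at ht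
    simp only [Pi.add_apply, Pi.neg_apply, clamp_of_mem ht]
  · filter_upwards [hw.ae_hasDerivAt_clamp hκ hf hwL x,
      (Ioo_ae_eq_Icc (a := (0 : ℝ)) (b := T) (μ := volume)).mem_iff] with r hr hmem hrI
    have hrO := hmem.2 hrI
    -- The drift `-ε` pays for the `ε` lost by choosing a nearly optimal action.
    have h1 : HasDerivAt (fun t => ε * (T - clamp T t)) (ε * -1) r :=
      (((hasDerivAt_id r).const_sub T).const_mul ε).congr_of_eventuallyEq (by
        filter_upwards [Icc_mem_nhds hrO.1 hrO.2] with s hs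
        rw [clamp_of_mem hs, id])
    refine ⟨_, (hr hrI).neg.add h1, ?_⟩
    have hm : BddLSC fun y => w (clamp T r) y := hwL.comp (by fun_prop : Continuous fun y => (r, y))
    obtain ⟨C, hC⟩ := hm.2
    have hi : Integrable (fun y => w (clamp T r) y) (controlledRate κ α (r, x)) :=
      Integrable.of_bound hm.measurable.aestronglyMeasurable C (ae_of_all _ hC)
    have h2 := controlled_generator_eq (κ := κ) hwL α r x
    have h3 := hα (r, x)
    simp only [controlledGain] at h2 h3 ⊢
    -- The correction `ε * (T - r)` is constant in space, so its integral cancels against its own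
    -- zero-order term.
    rw [integral_add hi.fun_neg (integrable_const _), integral_neg, integral_const, smul_eq_mul]
    have h4 : (controlledRate κ α (r, x)).real univ = jumpRate (controlledRate κ α) x r := rfl
    rw [h4]
    linarith

/-- A bounded lower semicontinuous solution of the HJB equation dominates the gains. -/
theorem IsHJBSolution.gain_le (hw : IsHJBSolution T κ f g w) (hT : 0 ≤ T) (hκ : IsFeller κ)
    (hf : BddLSC fun z : (ℝ × E) × A => f (clamp T z.1.1) z.1.2 z.2) (hg : BddLSC g)
    (hwL : BddLSC fun z : ℝ × E => w (clamp T z.1) z.2) {t : ℝ} (ht : t ∈ Icc 0 T) (x : E)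
    (α : Admissible E A) : gain T κ f g t x α ≤ w t x := by
  obtain ⟨C, hC⟩ := hw.isSupersolution hT hκ hf hg hwL α
  have h := hC.integral_pathGain_le ht x
  rwa [clamp_of_mem ht, ← reward_eq_pathGain α ht] at h

/-- Almost optimal controls almost attain a solution of the HJB equation. -/
theorem IsHJBSolution.exists_le_gain (hw : IsHJBSolution T κ f g w) (hT : 0 ≤ T)
    (hκ : IsFeller κ) (hf : BddLSC fun z : (ℝ × E) × A => f (clamp T z.1.1) z.1.2 z.2)
    (hg : BddLSC g) (hwL : BddLSC fun z : ℝ × E => w (clamp T z.1) z.2) {t : ℝ}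
    (ht : t ∈ Icc 0 T) (x : E) {ε : ℝ} (hε : 0 < ε) :
    ∃ α : Admissible E A, w t x - ε * T ≤ gain T κ f g t x α := by
  obtain ⟨α, C, hC⟩ := hw.exists_isSupersolution_neg hT hκ hf hg hwL hε
  refine ⟨α, ?_⟩
  have h := hC.integral_pathGain_le ht x
  simp only [pathGain_neg, clamp_of_mem ht] at h
  rw [integral_neg, ← reward_eq_pathGain α ht] at h
  change -gain T κ f g t x α ≤ _ at h
  have := mul_nonneg hε.le ht.1
  linarith

/-- A bounded lower semicontinuous solution of the HJB equation is the value function. -/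
theorem IsHJBSolution.eq_value (hw : IsHJBSolution T κ f g w) (hT : 0 < T) (hκ : IsFeller κ)
    (hf : BddLSC fun z : (ℝ × E) × A => f (clamp T z.1.1) z.1.2 z.2) (hg : BddLSC g)
    (hwL : BddLSC fun z : ℝ × E => w (clamp T z.1) z.2) {t : ℝ} (ht : t ∈ Icc 0 T) (x : E) :
    BddAbove (range (gain T κ f g t x)) ∧ w t x = value T κ f g t x := by
  have hb : BddAbove (range (gain T κ f g t x)) := by
    refine ⟨w t x, ?_⟩
    rintro _ ⟨α, rfl⟩
    exact hw.gain_le hT.le hκ hf hg hwL ht x α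
  have : Nonempty (Admissible E A) := ⟨⟨fun _ => Classical.arbitrary A, measurable_const⟩⟩
  refine ⟨hb, le_antisymm (le_of_forall_pos_sub_le fun δ hδ => ?_)
    (ciSup_le fun α => hw.gain_le hT.le hκ hf hg hwL ht x α)⟩
  -- A rate of loss `δ / T` over a horizon `T` costs `δ` in total.
  obtain ⟨α, hα⟩ := hw.exists_le_gain hT.le hκ hf hg hwL ht x (div_pos hδ hT)
  rw [div_mul_cancel₀ δ hT.ne'] at hα
  exact hα.trans (le_ciSup hb α)

end Verification

end PureJump

end

theorem mainTheorem4 {E A : Type*}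
    [TopologicalSpace E] [MeasurableSpace E] [BorelSpace E]
    [TopologicalSpace A] [MeasurableSpace A] [BorelSpace A] [Nonempty A]
    (hE : PureJump.IsLusinSpace E) (hA : PureJump.IsLusinSpace A)
    (T : ℝ) (hT : 0 < T)
    (κ : ProbabilityTheory.Kernel (E × A) E) [ProbabilityTheory.IsFiniteKernel κ]
    (hκ : PureJump.IsFeller κ)
    (f : ℝ → E → A → ℝ)
    (hf : PureJump.IsLSCb (fun z : ℝ × E × A => f z.1 z.2.1 z.2.2) (Set.Icc 0 T ×ˢ Set.univ))
    (g : E → ℝ) (hg : PureJump.IsLSCb g Set.univ) :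
    (∀ t ∈ Set.Icc 0 T, ∀ (x : E) (α : PureJump.Admissible E A),
      MeasureTheory.Integrable (PureJump.reward T f g α t) (PureJump.controlledLaw κ α t x)) ∧
    ∃ v : ℝ → E → ℝ,
      (PureJump.IsLSCb (fun z : ℝ × E => v z.1 z.2) (Set.Icc 0 T ×ˢ Set.univ) ∧
        PureJump.IsHJBSolution T κ f g v) ∧
      (∀ w : ℝ → E → ℝ,
        PureJump.IsLSCb (fun z : ℝ × E => w z.1 z.2) (Set.Icc 0 T ×ˢ Set.univ) →
        PureJump.IsHJBSolution T κ f g w → ∀ t ∈ Set.Icc 0 T, ∀ x, w t x = v t x) ∧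
      ∀ t ∈ Set.Icc 0 T, ∀ x,
        BddAbove (Set.range (PureJump.gain T κ f g t x)) ∧ v t x = PureJump.value T κ f g t x := by
  open PureJump Set in
  obtain ⟨_, _⟩ := hE.isSeparable_metrizable
  obtain ⟨_, _⟩ := hA.isSeparable_metrizable
  have hfL : BddLSC fun z : (ℝ × E) × A => f (clamp T z.1.1) z.1.2 z.2 :=
    hf.comp (i := fun z : (ℝ × E) × A => (clamp T z.1.1, z.1.2, z.2))
      (by have := continuous_clamp T; fun_prop)
      fun z => ⟨⟨clamp_nonneg _ _, clamp_le hT.le _⟩, mem_univ _⟩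
  have hgL : BddLSC g := hg.comp continuous_id fun _ => mem_univ _
  have hwL : ∀ w : ℝ → E → ℝ, IsLSCb (fun z : ℝ × E => w z.1 z.2) (Icc 0 T ×ˢ univ) →
      BddLSC fun z : ℝ × E => w (clamp T z.1) z.2 := fun w hw =>
    hw.comp (i := fun z : ℝ × E => (clamp T z.1, z.2))
      (by have := continuous_clamp T; fun_prop)
      fun z => ⟨⟨clamp_nonneg _ _, clamp_le hT.le _⟩, mem_univ _⟩
  refine ⟨fun t ht x α => integrable_reward hfL hgL ht x α, ?_⟩
  -- The uniformization constant is `Λ = κ.bound.toReal`.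
  obtain ⟨v, hvL, hv⟩ := exists_bddLSC_bellman_eq hκ ENNReal.toReal_nonneg
    (real_univ_le_bound κ) hT.le hfL hgL
  have hvH : IsHJBSolution T κ f g fun t x => v (t, x) :=
    isHJBSolution_of_bellman_eq hκ ENNReal.toReal_nonneg (real_univ_le_bound κ) hT hfL
      (fun t ht x a => by rw [clamp_of_mem ht]) hvL hv
  have hvB : IsLSCb (fun z : ℝ × E => v (z.1, z.2)) (Icc 0 T ×ˢ univ) :=
    ⟨hvL.1.lowerSemicontinuousOn _, hvL.2.imp fun C hC z _ => hC z⟩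
  have hvV := fun t ht x => hvH.eq_value hT hκ hfL hgL 
    (hwL (fun t x => v (t, x)) hvB) (t := t) ht x
  -- Uniqueness: two solutions in the class both equal the value function.
  exact ⟨fun t x => v (t, x), ⟨hvB, hvH⟩, fun w hw hwH t ht x =>
    (hwH.eq_value hT hκ hfL hgL (hwL w hw) ht x).2.trans (hvV t ht x).2.symm, hvV⟩
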